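/- Let $A$ be a partially ordered set with a top element $\top$ and a bottom element $\bot$. **Games.** Games over $A$ are defined inductively: for every $a\in A$ there is an atomic game $[a]$, which has no options, and for all non-empty sets $L,R$ of games there is a composite game $\{L\mid R\}$, whose left options are the elements of $L$ and whose right options are the elements of $R$. The positions of a game $G$ are $G$ itself, its left and right options, their options, and so on; $G$ is finite if it has finitely many positions. The depth of a finite game is $0$ if it is atomic, and otherwise one more than the maximum depth of its options. The branching factor of a finite game $G$ is the maximum, over all positions $H$ of $G$, of the number of left options and of the number of right options of $H$. **Order.** The relations $\leq$ and $\vartriangleleft$ on games are defined by mutual recursion. $G\leq H$ holds iff $G^L\vartriangleleft H$ for all left options $G^L$ of $G$, and $G\vartriangleleft H^R$ for all right options $H^R$ of $H$, and, in case $G$ or $H$ is atomic, $G\vartriangleleft H$. $G\vartriangleleft H$ holds iff $G^R\leq H$ for some right option $G^R$ of $G$, or $G\leq H^L$ for some left option $H^L$ of $H$, or $G=[a]$ and $H=[b]$ are atomic with $a\leq b$. Games $G,H$ are equivalent if $G\leq H$ and $H\leq G$. A left option $G^L$ of $G$ is good if $G\leq G^L$, and a right option $G^R$ of $G$ is good if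 $G^R\leq G$. A game is monotone if in each of its positions all left and right options are good, and passable if each of its positions is atomic or has at least one good left or right option. **Monotone set coloring games.** A monotone set coloring game $S$ over $A$ consists of a finite set $|S|$ of cells and a payoff function $\pi_S:\{\bot,\top\}^{|S|}\to A$ that is monotone for the pointwise order with $\bot<\top$. To each map $p:|S|\to\{\top,\bot,\star\}$, where $\star$ marks an empty cell, one associates a game $[\![p]\!]$ over $A$: it is $[\pi_S(p)]$ if $p$ has no empty cell, and otherwise it is the composite game whose left (right) options are the games $[\![p']\!]$, where $p'$ is obtained from $p$ by giving exactly one empty cell the color $\top$ (respectively $\bot$). The game $[\![S]\!]$ is $[\![p]\!]$ for the $p$ in which all cells are empty. A game $G$ over $A$ is realizable with size $n$ if $G$ is equivalent to $[\![S]\!]$ for some monotone set coloring game $S$ over $A$ with exactly $n$ cells. **Proposition 4.5.** Let $G$ be a finite game over $A$, and let $d$ and $b$ be its depth and branching factor, respectively. (a) If $G$ is monotone, then $G$ is realizable with size $(2^d-1)(4\lceil\log_2 b\rceil+7)$. (b) If $G$ is passable, then $G$ is realizable with size $(2^d-1)(4\lceil\log_2 b\rceil+10)$. (If $d=0$, then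 $b=0$ and both sizes are read as $0$.) -/

import Mathlib

universe u

namespace PosetGame

/-! ### Games over a set of atoms -/

/-- One layer of a game over `A`: either an atom, or a pair of non-empty sets (of left options
and of right options).  `Small` says that they are sets, as opposed to proper classes. -/
def Layer (A : Type u) (X : Type (u + 1)) : Type (u + 1) :=
  A ⊕ {LR : Set X × Set X // LR.1.Nonempty ∧ LR.2.Nonempty ∧ Small.{u} LR.1 ∧ Small.{u} LR.2}

/-- Presentation of `Layer A` by families of options, indexed by non-empty types. -/
def layerShape (A : Type u) : PFunctor.{u + 1, u + 1} where
  A := A ⊕ {p : Type u × Type u // Nonempty p.1 ∧ Nonempty p.2}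
  B s := match s with
    | .inl _ => PEmpty
    | .inr p => ULift.{u + 1} (p.1.1 ⊕ p.1.2)

/-- The functorial action of `Layer A`: take the image of both sets of options. -/
def Layer.map {A : Type u} {X Y : Type (u + 1)} (f : X → Y) : Layer A X → Layer A Y
  | .inl a => .inl a
  | .inr x => .inr ⟨(f '' x.1.1, f '' x.1.2), x.2.1.image f, x.2.2.1.image f,
      @small_image _ _ f _ x.2.2.2.1, @small_image _ _ f _ x.2.2.2.2⟩

instance (A : Type u) : Functor (Layer A) where
  map := Layer.map

/-- From families of options to sets of options. -/
def Layer.abs {A : Type u} {X : Type (u + 1)} : layerShape A X → Layer A X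
  | ⟨.inl a, _⟩ => .inl a
  | ⟨.inr p, f⟩ => .inr ⟨(Set.range fun i => f ⟨.inl i⟩, Set.range fun j => f ⟨.inr j⟩),
      @Set.range_nonempty _ _ p.2.1 _, @Set.range_nonempty _ _ p.2.2 _,
      small_range _, small_range _⟩

/-- Index the sets of options by themselves. -/
noncomputable def Layer.repr {A : Type u} {X : Type (u + 1)} : Layer A X → layerShape A X
  | .inl a => ⟨.inl a, fun i => nomatch i⟩
  | .inr x =>
      haveI : Small.{u} x.1.1 := x.2.2.2.1
      haveI : Small.{u} x.1.2 := x.2.2.2.2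
      ⟨.inr ⟨(Shrink.{u} x.1.1, Shrink.{u} x.1.2),
          x.2.1.to_subtype.map (equivShrink _), x.2.2.1.to_subtype.map (equivShrink _)⟩,
        fun i => Sum.elim (fun i => ((equivShrink x.1.1).symm i).1)
          (fun j => ((equivShrink x.1.2).symm j).1) (ULift.down i)⟩

noncomputable instance (A : Type u) : QPF (Layer A) where
  P := layerShape A
  abs := Layer.abs
  repr := Layer.repr
  abs_repr := by
    rintro X (a | x)
    · rfl
    · have : Small.{u} x.1.1 := x.2.2.2.1
      have : Small.{u} x.1.2 := x.2.2.2.2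
      have h (s : Set X) [Small.{u} s] :
          (Set.range fun i => ((equivShrink s).symm i).1) = s := by
        rw [show (fun i => ((equivShrink s).symm i).1) = Subtype.val ∘ (equivShrink s).symm
          from rfl, EquivLike.range_comp, Subtype.range_coe]
      exact congrArg Sum.inr (Subtype.ext (Prod.ext (h x.1.1) (h x.1.2)))
  abs_map := by
    rintro X Y f ⟨(a | p), g⟩
    · rfl
    · exact congrArg Sum.inr (Subtype.ext (Prod.ext
        (Set.range_comp f (fun i : p.1.1 => g ⟨.inl i⟩))
        (Set.range_comp f (fun j : p.1.2 => g ⟨.inr j⟩))))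

/-- Combinatorial games over `A`: the smallest class that contains an atomic game `[a]` for every
`a : A`, and a game `{L | R}` for all non-empty sets `L`, `R` of games (the initial algebra of
`Layer A`).  Options form honest sets, so repeated options are counted once. -/
def Game (A : Type u) : Type (u + 1) := QPF.Fix (Layer A)

namespace Game

variable {A : Type u}

/-- The atomic game `[a]`. -/
noncomputable def atom (a : A) : Game A := QPF.Fix.mk (F := Layer A) (Sum.inl a)

/-- The composite game `{L | R}`. -/
noncomputable def comp (L R : Set (Game A)) (hL : L.Nonempty) (hR : R.Nonempty)
    [sL : Small.{u} L] [sR : Small.{u} R] : Game A :=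
  QPF.Fix.mk (F := Layer A) (Sum.inr ⟨(L, R), hL, hR, sL, sR⟩)

/-- The set of left options; it is empty if the game is atomic. -/
noncomputable def leftOptions (G : Game A) : Set (Game A) :=
  match (QPF.Fix.dest G : Layer A (Game A)) with
  | .inl _ => ∅
  | .inr x => x.1.1

/-- The set of right options; it is empty if the game is atomic. -/
noncomputable def rightOptions (G : Game A) : Set (Game A) :=
  match (QPF.Fix.dest G : Layer A (Game A)) with
  | .inl _ => ∅
  | .inr x => x.1.2

@[simp] theorem leftOptions_atom (a : A) : (atom a).leftOptions = ∅ := by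
  unfold leftOptions atom
  erw [QPF.Fix.dest_mk]

@[simp] theorem rightOptions_atom (a : A) : (atom a).rightOptions = ∅ := by
  unfold rightOptions atom
  erw [QPF.Fix.dest_mk]

@[simp] theorem leftOptions_comp (L R : Set (Game A)) (hL : L.Nonempty) (hR : R.Nonempty)
    [Small.{u} L] [Small.{u} R] : (comp L R hL hR).leftOptions = L := by
  unfold leftOptions comp
  erw [QPF.Fix.dest_mk]

@[simp] theorem rightOptions_comp (L R : Set (Game A)) (hL : L.Nonempty) (hR : R.Nonempty)
    [Small.{u} L] [Small.{u} R] : (comp L R hL hR).rightOptions = R := by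
  unfold rightOptions comp
  erw [QPF.Fix.dest_mk]

theorem atom_injective : Function.Injective (atom : A → Game A) := by
  intro a b h
  have h' := congrArg (QPF.Fix.dest (F := Layer A)) h
  unfold atom at h'
  erw [QPF.Fix.dest_mk, QPF.Fix.dest_mk] at h'
  exact Sum.inl.inj h'

/-- The induction principle for games. -/
theorem induction {p : Game A → Prop} (h_atom : ∀ a, p (atom a))
    (h_comp : ∀ (L R : Set (Game A)) (hL : L.Nonempty) (hR : R.Nonempty)
      [Small.{u} L] [Small.{u} R],
      (∀ G ∈ L, p G) → (∀ G ∈ R, p G) → p (comp L R hL hR)) (G : Game A) : p G := by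
  refine QPF.Fix.ind (F := Layer A) p ?_ G
  rintro x ⟨y, rfl⟩
  rcases y with a | ⟨⟨L, R⟩, hL, hR, sL, sR⟩
  · exact h_atom a
  · have : Small.{u} (Subtype.val '' L : Set (Game A)) := @small_image _ _ _ L sL
    have : Small.{u} (Subtype.val '' R : Set (Game A)) := @small_image _ _ _ R sR
    refine h_comp (Subtype.val '' L) (Subtype.val '' R) (hL.image _) (hR.image _) ?_ ?_
    · rintro _ ⟨H, _, rfl⟩
      exact H.2
    · rintro _ ⟨H, _, rfl⟩
      exact H.2

/-- `H.IsOption G`: the game `H` is a left or a right option of `G`. -/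
def IsOption (H G : Game A) : Prop := H ∈ G.leftOptions ∨ H ∈ G.rightOptions

theorem wellFounded_isOption : WellFounded (IsOption : Game A → Game A → Prop) := by
  refine ⟨fun G => ?_⟩
  induction G using induction with
  | h_atom a =>
    refine ⟨_, fun H hH => ?_⟩
    simp [IsOption] at hH
  | h_comp L R hL hR ihL ihR =>
    refine ⟨_, fun H hH => ?_⟩
    simp only [IsOption, leftOptions_comp, rightOptions_comp] at hH
    exact hH.elim (ihL H) (ihR H)

instance : WellFoundedRelation (Game A) := ⟨IsOption, wellFounded_isOption⟩

/-- A game is atomic if it is of the form `[a]`. -/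
def IsAtomic (G : Game A) : Prop := ∃ a, G = atom a

/-- The positions of `G`: the game `G`, its options, their options, and so on. -/
def positions (G : Game A) : Set (Game A) := {H | Relation.ReflTransGen IsOption H G}

/-- A game is finite if it has finitely many positions. -/
def IsFinite (G : Game A) : Prop := G.positions.Finite

/-- The depth of a finite game: `0` for an atomic game, and one more than the maximum of the
depths of the options for a composite one. -/
noncomputable def depth (G : Game A) : ℕ :=
  ⨆ H : {H : Game A // IsOption H G}, (depth H.1 + 1)
termination_by G
decreasing_by exact H.2

/-- The branching factor of a finite game: the maximum number of left options or right options
of any position. -/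
noncomputable def branchingFactor (G : Game A) : ℕ :=
  sSup {n | ∃ H ∈ G.positions, n = H.leftOptions.ncard ∨ n = H.rightOptions.ncard}

/-! ### The order on games -/

section Order

variable [PartialOrder A]

/- The relations `G ≤ H` (`Le G H`) and `G ⊲ H` (`Tri G H`), by mutual recursion.  As the
option relation is well-founded, the recursive clauses determine both relations; they are
recorded as equivalences in `le_iff` and `tri_iff`. -/
mutual

inductive Le : Game A → Game A → Prop
  | intro (G H : Game A)
      (left : ∀ K ∈ G.leftOptions, Tri K H)
      (right : ∀ K ∈ H.rightOptions, Tri G K)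
      (atomic : G.IsAtomic ∨ H.IsAtomic → Tri G H) : Le G H

inductive Tri : Game A → Game A → Prop
  | right (G H K : Game A) (mem : K ∈ G.rightOptions) (le : Le K H) : Tri G H
  | left (G H K : Game A) (mem : K ∈ H.leftOptions) (le : Le G K) : Tri G H
  | atom (a b : A) (le : a ≤ b) : Tri (atom a) (atom b)

end

theorem le_iff {G H : Game A} :
    Le G H ↔ (∀ K ∈ G.leftOptions, Tri K H) ∧ (∀ K ∈ H.rightOptions, Tri G K) ∧
      (G.IsAtomic ∨ H.IsAtomic → Tri G H) :=
  ⟨fun | .intro _ _ h₁ h₂ h₃ => ⟨h₁, h₂, h₃⟩, fun ⟨h₁, h₂, h₃⟩ => .intro G H h₁ h₂ h₃⟩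

theorem tri_iff {G H : Game A} :
    Tri G H ↔ (∃ K ∈ G.rightOptions, Le K H) ∨ (∃ K ∈ H.leftOptions, Le G K) ∨
      (∃ a b, G = atom a ∧ H = atom b ∧ a ≤ b) := by
  constructor
  · rintro (⟨_, _, K, hK, h⟩ | ⟨_, _, K, hK, h⟩ | ⟨a, b, h⟩)
    · exact .inl ⟨K, hK, h⟩
    · exact .inr (.inl ⟨K, hK, h⟩)
    · exact .inr (.inr ⟨a, b, rfl, rfl, h⟩)
  · rintro (⟨K, hK, h⟩ | ⟨K, hK, h⟩ | ⟨a, b, rfl, rfl, h⟩)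
    · exact .right G H K hK h
    · exact .left G H K hK h
    · exact .atom a b h

/-- Equivalence of games. -/
def Equivalent (G H : Game A) : Prop := Le G H ∧ Le H G

/-- All left and right options are good (vacuous for atomic games). -/
def LocallyMonotone (G : Game A) : Prop :=
  (∀ K ∈ G.leftOptions, Le G K) ∧ (∀ K ∈ G.rightOptions, Le K G)

/-- The game is atomic, or it has a good left option or a good right option. -/
def LocallyPassable (G : Game A) : Prop :=
  G.IsAtomic ∨ (∃ K ∈ G.leftOptions, Le G K) ∨ (∃ K ∈ G.rightOptions, Le K G)

/-- All positions are locally monotone. -/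
def IsMonotone (G : Game A) : Prop := ∀ H ∈ G.positions, H.LocallyMonotone

/-- All positions are locally passable. -/
def IsPassable (G : Game A) : Prop := ∀ H ∈ G.positions, H.LocallyPassable

end Order

end Game

/-! ### Monotone set coloring games -/

/-- A monotone set coloring game over `A`: a finite set of cells and a monotone payoff function.
The Boolean `true` is the color of the left player, `false` that of the right player. -/
structure SetColoringGame (A : Type u) [PartialOrder A] where
  /-- The set of cells. -/
  carrier : Type
  /-- There are finitely many cells. -/
  finite_carrier : Finite carrier
  /-- The payoff function, monotone for the pointwise order with `false < true`. -/
  payoff : (carrier → Bool) →o A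

namespace SetColoringGame

variable {A : Type u} [PartialOrder A] (S : SetColoringGame A)

/-- The size: the number of cells. -/
noncomputable def size : ℕ := Nat.card S.carrier

/-- A position colors some of the cells; `none` marks an empty cell. -/
abbrev Position : Type := S.carrier → Option Bool

/-- The empty cells of a position. -/
abbrev EmptyCell (p : S.Position) : Type := {c : S.carrier // p c = none}

/-- The position obtained from `p` by coloring the cell `c` with the color `x`. -/
noncomputable def color (p : S.Position) (c : S.carrier) (x : Bool) : S.Position :=
  open Classical in Function.update p c (some x)

theorem card_emptyCell_color_lt (p : S.Position) (c : S.EmptyCell p) (x : Bool) :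
    Nat.card (S.EmptyCell (S.color p c.1 x)) < Nat.card (S.EmptyCell p) := by
  classical
  have := S.finite_carrier
  refine Set.ncard_lt_ncard (s := {d | S.color p c.1 x d = none}) (t := {d | p d = none}) ?_
    (Set.toFinite _)
  refine ⟨fun d hd => ?_, fun h => ?_⟩
  · by_cases hdc : d = c.1
    · subst hdc
      exact c.2
    · have h' : S.color p c.1 x d = p d := by
        unfold color
        exact Function.update_of_ne hdc _ _
      exact h'.symm.trans hd
  · have h' : S.color p c.1 x c.1 = some x := by
      unfold color
      exact Function.update_self _ _ _
    exact Option.some_ne_none x (h'.symm.trans (h c.2))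

/-- The game associated to a position `p`: the atomic game given by the payoff if there is no
empty cell; otherwise the left (right) options are the games associated to the positions in which
one empty cell of `p` has been colored by the left (right) player. -/
noncomputable def positionValue (p : S.Position) : Game A :=
  open Classical in
  if h : Nonempty (S.EmptyCell p) then
    haveI := h
    haveI := S.finite_carrier
    Game.comp
      (Set.range fun c : S.EmptyCell p => positionValue (S.color p c.1 true))
      (Set.range fun c : S.EmptyCell p => positionValue (S.color p c.1 false))
      (Set.range_nonempty _) (Set.range_nonempty _)
  else
    Game.atom (S.payoff fun c => (p c).get
      (Option.isSome_iff_ne_none.2 fun hc => h ⟨⟨c, hc⟩⟩))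
termination_by Nat.card (S.EmptyCell p)
decreasing_by all_goals exact S.card_emptyCell_color_lt p c _

/-- The game associated to `S`: that of the position in which all cells are empty. -/
noncomputable def value : Game A := S.positionValue fun _ => none

end SetColoringGame

/-- `G` is realizable with size `n`: it is equivalent to the game associated to some monotone set
coloring game with exactly `n` cells. -/
def Game.RealizableWithSize {A : Type u} [PartialOrder A] (G : Game A) (n : ℕ) : Prop :=
  ∃ S : SetColoringGame A, S.size = n ∧ G.Equivalent S.value

end PosetGame

-- The proof builds a set coloring game for a composite game from set coloring games for its
-- options. Suppose that every option of `G` is realized on `n` cells. The new game has a switch on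
-- cells `E` and further cells `Z`. The coloring of `E` is a win for one of the players or a symbol
-- of one of the players, and a symbol names an option of that player, whose payoff function is then
-- used on `Z`. A player who moves first can secure any of their available symbols with `Z`
-- untouched, which imitates a move in `G`.
--
-- The difficulty is that a player may also move in `Z`, or play in the switch without choosing a
-- symbol. Good options take care of this. If `G` is monotone, then `Z` consists of two copies of
-- the `n` cells and a symbol also names a copy; when the opponent spoils one copy, the player
-- answers with a good option on the other one, which is at least as good as `G`. If only one player
-- `g` has a good option, then each copy receives an additional cell. The other player replaces the
-- missing good option by a threat: they win by coloring that cell, so `g` has to color it, and this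
-- leaves the good option of `g`, a move that `g` has in `G` as well.
--
-- What a switch must provide is recorded in `SwitchStrategy`, and
-- `SwitchStrategy.sLe_switchGame_value` shows that it suffices. Two small switches, with 7 and 8
-- cells, are given by explicit tables that are verified by computation. `SwitchStrategy.extend`
-- doubles the number of symbols at the cost of four cells, so `k` extensions number up to `2 ^ k`
-- options of each player. One level of the game therefore turns size `n` into `2 * n + c` with `c =
-- 4 * k + 7` or `c = 8 + 4 * k + 2`, and this recurrence has the solution `(2 ^ d - 1) * c`.
--
-- The two players are treated at once by the relations `SLe s` and `STri s`, which are `≤` and `⊲`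
-- read from the side of the player `s`.

namespace PosetGame

open Game

/-! ### The order, seen from the side of one of the players -/

/-- The order of `A`, read upwards for the left player and downwards for the right player. -/
def sideLe {A : Type*} [LE A] (s : Bool) (a b : A) : Prop := if s then a ≤ b else b ≤ a

theorem sideLe_refl {A : Type*} [Preorder A] (s : Bool) (a : A) : sideLe s a a := by
  cases s <;> simp [sideLe]

theorem sideLe_trans {A : Type*} [Preorder A] {s : Bool} {a b c : A} (h : sideLe s a b)
    (h' : sideLe s b c) : sideLe s a c := by
  cases s
  · exact le_trans (α := A) h' h
  · exact le_trans (α := A) h h'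

namespace Game

variable {A : Type*}

/-- The options of the player `s`. -/
noncomputable def opts (s : Bool) (G : Game A) : Set (Game A) :=
  if s then G.leftOptions else G.rightOptions

@[simp] theorem opts_atom (s : Bool) (a : A) : opts s (atom a) = ∅ := by
  cases s <;> simp [opts]

theorem isOption_of_mem_opts {s : Bool} {G H : Game A} (h : H ∈ opts s G) : IsOption H G := by
  cases s
  · exact .inr h
  · exact .inl h

theorem option_induction {p : Game A → Prop}
    (h : ∀ G, (∀ s, ∀ K ∈ opts s G, p K) → p G) (G : Game A) : p G :=
  wellFounded_isOption.induction G fun G ih => h G fun _ _ hK => ih _ (isOption_of_mem_opts hK)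

theorem isAtomic_or_opts_nonempty (G : Game A) : G.IsAtomic ∨ ∀ s, (opts s G).Nonempty := by
  induction G using induction with
  | h_atom a => exact .inl ⟨a, rfl⟩
  | h_comp L R hL hR _ _ =>
    refine .inr fun s => ?_
    cases s
    · simpa [opts] using hR
    · simpa [opts] using hL

variable [PartialOrder A]

/-- The relation `≤` from the side of the player `s`. -/
def SLe (s : Bool) (G H : Game A) : Prop := if s then Le G H else Le H G

/-- The relation `⊲` from the side of the player `s`. -/
def STri (s : Bool) (G H : Game A) : Prop := if s then Tri G H else Tri H G

theorem sLe_iff {s : Bool} {G H : Game A} :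
    SLe s G H ↔ (∀ K ∈ opts s G, STri s K H) ∧ (∀ K ∈ opts (!s) H, STri s G K) ∧
      (G.IsAtomic ∨ H.IsAtomic → STri s G H) := by
  cases s
  · simp only [SLe, STri, opts, Bool.not_false, if_true, Bool.false_eq_true, if_false]
    rw [le_iff, or_comm]
    tauto
  · simp only [SLe, STri, opts, Bool.not_true, if_true, Bool.false_eq_true, if_false]
    exact le_iff

theorem sTri_iff {s : Bool} {G H : Game A} :
    STri s G H ↔ (∃ K ∈ opts (!s) G, SLe s K H) ∨ (∃ K ∈ opts s H, SLe s G K) ∨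
      (∃ a b, G = atom a ∧ H = atom b ∧ sideLe s a b) := by
  cases s
  · simp only [SLe, STri, opts, sideLe, Bool.not_false, if_true, Bool.false_eq_true, if_false]
    rw [tri_iff]
    constructor
    · rintro (h | h | ⟨a, b, h₁, h₂, h₃⟩)
      · exact .inr (.inl h)
      · exact .inl h
      · exact .inr (.inr ⟨b, a, h₂, h₁, h₃⟩)
    · rintro (h | h | ⟨a, b, h₁, h₂, h₃⟩)
      · exact .inr (.inl h)
      · exact .inl h
      · exact .inr (.inr ⟨b, a, h₂, h₁, h₃⟩)
  · simp only [SLe, STri, opts, sideLe, Bool.not_true, if_true, Bool.false_eq_true, if_false]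
    exact tri_iff

theorem SLe.sTri_of_mem_left {s : Bool} {G H K : Game A} (h : SLe s G H) (hK : K ∈ opts s G) :
    STri s K H := (sLe_iff.1 h).1 K hK

theorem SLe.sTri_of_mem_right {s : Bool} {G H K : Game A} (h : SLe s G H)
    (hK : K ∈ opts (!s) H) : STri s G K := (sLe_iff.1 h).2.1 K hK

theorem sTri_of_reply_left {s : Bool} {G H K : Game A} (hK : K ∈ opts (!s) G)
    (h : SLe s K H) : STri s G H := sTri_iff.2 (.inl ⟨K, hK, h⟩)

theorem sTri_of_reply_right {s : Bool} {G H K : Game A} (hK : K ∈ opts s H)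
    (h : SLe s G K) : STri s G H := sTri_iff.2 (.inr (.inl ⟨K, hK, h⟩))

theorem sTri_atom {s : Bool} {a b : A} (h : sideLe s a b) : STri s (atom a) (atom b) :=
  sTri_iff.2 (.inr (.inr ⟨a, b, rfl, rfl, h⟩))

/-- The three transitivity laws. -/
theorem trans_aux {s : Bool} (G H K : Game A) :
    (SLe s G H → SLe s H K → SLe s G K) ∧ (STri s G H → SLe s H K → STri s G K) ∧
      (SLe s G H → STri s H K → STri s G K) := by
  induction G using option_induction generalizing H K with | _ G ihG
  induction H using option_induction generalizing K with | _ H ihH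
  induction K using option_induction with | _ K ihK
  have h2 : STri s G H → SLe s H K → STri s G K := by
    intro h h'
    obtain ⟨X, hX, hXH⟩ | ⟨X, hX, hGX⟩ | ⟨a, b, rfl, rfl, hab⟩ := sTri_iff.1 h
    · exact sTri_of_reply_left hX ((ihG _ X hX H K).1 hXH h')
    · exact (ihH _ X hX K).2.2 hGX (h'.sTri_of_mem_left hX)
    -- Here the atomic clause of `≤` is essential: it turns `[b] ≤ K` into `[b] ⊲ K`.
    · obtain ⟨X, hX, -⟩ | ⟨X, hX, hX'⟩ | ⟨b', c, hb, rfl, hbc⟩ :=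
        sTri_iff.1 ((sLe_iff.1 h').2.2 (.inl ⟨b, rfl⟩))
      · simp at hX
      · refine sTri_of_reply_right hX ((ihK _ X hX).1 ?_ hX')
        rw [sLe_iff]
        simp only [opts_atom]
        exact ⟨by simp, by simp, fun _ => sTri_atom hab⟩
      · obtain rfl := atom_injective hb
        exact sTri_atom (sideLe_trans hab hbc)
  have h3 : SLe s G H → STri s H K → STri s G K := by
    intro h h'
    obtain ⟨X, hX, hXK⟩ | ⟨X, hX, hHX⟩ | ⟨b, c, rfl, rfl, hbc⟩ := sTri_iff.1 h'
    · exact (ihH _ X hX K).2.1 (h.sTri_of_mem_right hX) hXK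
    · exact sTri_of_reply_right hX ((ihK _ X hX).1 h hHX)
    · obtain ⟨X, hX, hX'⟩ | ⟨X, hX, -⟩ | ⟨a, b', rfl, hb, hab⟩ :=
        sTri_iff.1 ((sLe_iff.1 h).2.2 (.inr ⟨b, rfl⟩))
      · refine sTri_of_reply_left hX ((ihG _ X hX _ _).1 hX' ?_)
        rw [sLe_iff]
        simp only [opts_atom]
        exact ⟨by simp, by simp, fun _ => sTri_atom hbc⟩
      · simp at hX
      · obtain rfl := atom_injective hb
        exact sTri_atom (sideLe_trans hab hbc)
  refine ⟨fun h h' => sLe_iff.2 ⟨fun X hX => ?_, fun X hX => ?_, ?_⟩, h2, h3⟩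
  · exact (ihG _ X hX H K).2.1 (h.sTri_of_mem_left hX) h'
  · exact (ihK _ X hX).2.2 h (h'.sTri_of_mem_right hX)
  · rintro (hG | hK)
    · exact h2 ((sLe_iff.1 h).2.2 (.inl hG)) h'
    · exact h3 h ((sLe_iff.1 h').2.2 (.inr hK))

theorem SLe.trans {s : Bool} {G H K : Game A} (h : SLe s G H) (h' : SLe s H K) : SLe s G K :=
  (trans_aux G H K).1 h h'

theorem STri.trans_sLe {s : Bool} {G H K : Game A} (h : STri s G H) (h' : SLe s H K) :
    STri s G K :=
  (trans_aux G H K).2.1 h h'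

theorem SLe.trans_sTri {s : Bool} {G H K : Game A} (h : SLe s G H) (h' : STri s H K) :
    STri s G K :=
  (trans_aux G H K).2.2 h h'

theorem SLe.refl (s : Bool) (G : Game A) : SLe s G G := by
  induction G using option_induction with | _ G ih
  refine sLe_iff.2 ⟨fun X hX => sTri_of_reply_right hX (ih _ X hX),
    fun X hX => sTri_of_reply_left hX (ih _ X hX), fun h => ?_⟩
  obtain ⟨a, rfl⟩ : G.IsAtomic := by tauto
  exact sTri_atom (sideLe_refl s a)

theorem equivalent_iff_sLe {G H : Game A} : G.Equivalent H ↔ ∀ s, SLe s G H := by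
  constructor
  · rintro ⟨h, h'⟩ (_ | _)
    · exact h'
    · exact h
  · exact fun h => ⟨h true, h false⟩

theorem Equivalent.sLe {G H : Game A} (h : G.Equivalent H) (s : Bool) : SLe s G H :=
  equivalent_iff_sLe.1 h s

theorem Equivalent.symm {G H : Game A} (h : G.Equivalent H) : H.Equivalent G := ⟨h.2, h.1⟩

theorem Equivalent.trans {G H K : Game A} (h : G.Equivalent H) (h' : H.Equivalent K) :
    G.Equivalent K :=
  equivalent_iff_sLe.2 fun s => (h.sLe s).trans (h'.sLe s)

end Game

/-! ### Positions of monotone set coloring games -/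

/-- The colors of a cell, compared from the side of the player `s`. -/
def CellLe (s : Bool) (x y : Option Bool) : Prop := x = y ∨ x = some !s ∨ y = some s

namespace SetColoringGame

variable {A : Type*} [PartialOrder A]

theorem color_self (S : SetColoringGame A) (p : S.Position) (c : S.carrier) (x : Bool) :
    S.color p c x c = some x := by
  classical
  unfold color
  exact Function.update_self _ _ _

theorem color_of_ne (S : SetColoringGame A) (p : S.Position) {c d : S.carrier} (x : Bool)
    (h : d ≠ c) : S.color p c x d = p d := by
  classical
  unfold color
  exact Function.update_of_ne h _ _

theorem opts_positionValue (S : SetColoringGame A) (s : Bool) (p : S.Position) :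
    opts s (S.positionValue p) = {K | ∃ c, p c = none ∧ K = S.positionValue (S.color p c s)} := by
  rw [positionValue]
  split_ifs with h
  · have := S.finite_carrier
    ext K
    cases s <;> simp [opts, eq_comm]
  · ext K
    simp only [opts_atom, Set.mem_empty_iff_false, Set.mem_ofPred_eq, false_iff]
    rintro ⟨c, hc, -⟩
    exact h ⟨⟨c, hc⟩⟩

theorem positionValue_some (S : SetColoringGame A) (w : S.carrier → Bool) :
    S.positionValue (fun c => some (w c)) = atom (S.payoff w) := by
  rw [positionValue, dif_neg]
  · rfl
  · rintro ⟨c, hc⟩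
    simp at hc

theorem exists_eq_some (S : SetColoringGame A) {p : S.Position} (h : ∀ c, p c ≠ none) :
    ∃ w : S.carrier → Bool, p = fun c => some (w c) := by
  choose w hw using fun c => Option.ne_none_iff_exists'.1 (h c)
  exact ⟨w, funext hw⟩

theorem ne_none_of_isAtomic (S : SetColoringGame A) {p : S.Position}
    (h : (S.positionValue p).IsAtomic) (c : S.carrier) : p c ≠ none := by
  obtain ⟨a, ha⟩ := h
  intro hc
  have : S.positionValue (S.color p c true) ∈ opts true (S.positionValue p) := by
    rw [opts_positionValue]
    exact ⟨c, hc, rfl⟩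
  simp [ha] at this

theorem mem_opts (S : SetColoringGame A) (s : Bool) {p : S.Position} {c : S.carrier}
    (hc : p c = none) :
    S.positionValue (S.color p c s) ∈ opts s (S.positionValue p) := by
  rw [opts_positionValue]
  exact ⟨c, hc, rfl⟩

/-- The number of empty cells. -/
noncomputable def emptyCount (S : SetColoringGame A) (p : S.Position) : ℕ :=
  Nat.card (S.EmptyCell p)

theorem emptyCount_color_lt (S : SetColoringGame A) {p : S.Position} {c : S.carrier}
    (hc : p c = none) (x : Bool) : S.emptyCount (S.color p c x) < S.emptyCount p :=
  S.card_emptyCell_color_lt p ⟨c, hc⟩ x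

/-- The player `s` mirrors moves along `f` and passes when a move has no counterpart. Passing is
possible because `⊲` is proved together with `≤`: for `⊲`, an additional move of `s` in `T`, or of
the opponent in `S`, only strengthens the comparison of cells. The payoffs need to be compared only
for colorings that extend `q`, a condition that becomes weaker as `q` is filled. -/
theorem compare_aux (S T : SetColoringGame A) (s : Bool) (f : S.carrier → T.carrier)
    (hf : Function.Injective f)
    (n : ℕ) (p : S.Position) (q : T.Position) (hn : S.emptyCount p + T.emptyCount q = n)
    (hpay : ∀ w : T.carrier → Bool, (∀ d x, q d = some x → w d = x) →
      sideLe s (S.payoff (w ∘ f)) (T.payoff w))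
    (hpq : ∀ c, CellLe s (p c) (q (f c))) :
    SLe s (S.positionValue p) (T.positionValue q) ∧
      STri s (S.positionValue p) (T.positionValue q) := by
  induction n using Nat.strong_induction_on generalizing p q with | _ n ih
  have payR {d} (x : Bool) (hd : q d = none) (w : T.carrier → Bool)
      (hw : ∀ d' y, T.color q d x d' = some y → w d' = y) :
      sideLe s (S.payoff (w ∘ f)) (T.payoff w) := by
    refine hpay w fun d' y hy => hw d' y ?_
    rwa [color_of_ne _ _ _ (by rintro rfl; simp [hd] at hy)]
  have upR {d} (x : Bool) (hd : q d = none)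
      (h : ∀ c, CellLe s (p c) (T.color q d x (f c))) :=
    ih _ (by have := T.emptyCount_color_lt hd x; omega) p (T.color q d x) rfl (payR x hd) h
  have upL {c} (x : Bool) (hc : p c = none)
      (h : ∀ c', CellLe s (S.color p c x c') (q (f c'))) :=
    ih _ (by have := S.emptyCount_color_lt hc x; omega) (S.color p c x) q rfl hpay h
  have tri : STri s (S.positionValue p) (T.positionValue q) := by
    by_cases hq : ∃ d, q d = none
    · obtain ⟨d, hd⟩ := hq
      refine sTri_of_reply_right (T.mem_opts s hd) (upR s hd fun c => ?_).1
      by_cases h : f c = d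
      · rw [h, color_self]
        exact .inr (.inr rfl)
      · rw [color_of_ne _ _ _ h]
        exact hpq c
    push Not at hq
    by_cases hp : ∃ c, p c = none
    · obtain ⟨c, hc⟩ := hp
      refine sTri_of_reply_left (S.mem_opts (!s) hc) (upL (!s) hc fun c' => ?_).1
      by_cases h : c' = c
      · rw [h, color_self]
        exact .inr (.inl rfl)
      · rw [color_of_ne _ _ _ h]
        exact hpq c'
    push Not at hp
    obtain ⟨v, rfl⟩ := S.exists_eq_some hp
    obtain ⟨w, rfl⟩ := T.exists_eq_some hq
    rw [positionValue_some, positionValue_some]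
    refine sTri_atom (sideLe_trans ?_ (hpay w fun _ _ => Option.some.inj))
    cases s
    · refine S.payoff.monotone fun c => ?_
      have := hpq c
      simp only [CellLe, Option.some.injEq] at this
      simp only [Function.comp]
      revert this
      cases v c <;> cases w (f c) <;> simp
    · refine S.payoff.monotone fun c => ?_
      have := hpq c
      simp only [CellLe, Option.some.injEq] at this
      simp only [Function.comp]
      revert this
      cases v c <;> cases w (f c) <;> simp
  refine ⟨sLe_iff.2 ⟨fun K hK => ?_, fun K hK => ?_, fun _ => tri⟩, tri⟩
  · rw [opts_positionValue] at hK
    obtain ⟨c, hc, rfl⟩ := hK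
    have hcq := hpq c
    rw [hc] at hcq
    obtain hcq | hcq | hcq := hcq
    · have hcq := hcq.symm
      refine sTri_of_reply_right (T.mem_opts s hcq) (ih _ ?_ _ _ rfl (payR s hcq) fun c' => ?_).1
      · have := S.emptyCount_color_lt hc s
        have := T.emptyCount_color_lt hcq s
        omega
      · by_cases h : c' = c
        · rw [h, color_self, color_self]
          exact .inl rfl
        · rw [color_of_ne _ _ _ h, color_of_ne _ _ _ (hf.ne h)]
          exact hpq c'
    · simp at hcq
    · refine (upL s hc fun c' => ?_).2
      by_cases h : c' = c
      · rw [h, color_self, hcq]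
        exact .inl rfl
      · rw [color_of_ne _ _ _ h]
        exact hpq c'
  · rw [opts_positionValue] at hK
    obtain ⟨d, hd, rfl⟩ := hK
    by_cases hex : ∃ c, f c = d ∧ p c = none
    · obtain ⟨c, rfl, hc⟩ := hex
      refine sTri_of_reply_left (S.mem_opts (!s) hc) (ih _ ?_ _ _ rfl (payR (!s) hd) fun c' => ?_).1
      · have := S.emptyCount_color_lt hc (!s)
        have := T.emptyCount_color_lt hd (!s)
        omega
      · by_cases h : c' = c
        · rw [h, color_self, color_self]
          exact .inl rfl
        · rw [color_of_ne _ _ _ h, color_of_ne _ _ _ (hf.ne h)]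
          exact hpq c'
    -- The opponent's move at `d` has no counterpart among the empty cells of `S`. If `d` comes from
    -- a cell of `S`, that cell already has the worst color for `s`, so `s` can pass.
    · refine (upR (!s) hd fun c => ?_).2
      by_cases h : f c = d
      · have := hpq c
        rw [h, hd] at this
        obtain h' | h' | h' := this
        · exact (hex ⟨c, h, h'⟩).elim
        · exact .inr (.inl h')
        · simp at h'
      · rw [color_of_ne _ _ _ h]
        exact hpq c

/-- A position of `S` is at most as good for the player `s` as a position of `T` in which all
cells of `S` have a color that is at least as good, if the payoffs compare for all colorings that
can still arise. -/
theorem positionValue_sLe_of_compatible (S T : SetColoringGame A) {s : Bool}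
    (f : S.carrier → T.carrier) (hf : Function.Injective f) {p : S.Position} {q : T.Position}
    (hpay : ∀ w : T.carrier → Bool, (∀ d x, q d = some x → w d = x) →
      sideLe s (S.payoff (w ∘ f)) (T.payoff w))
    (hpq : ∀ c, CellLe s (p c) (q (f c))) :
    SLe s (S.positionValue p) (T.positionValue q) :=
  (compare_aux S T s f hf _ p q rfl hpay hpq).1

theorem positionValue_sLe (S T : SetColoringGame A) {s : Bool} (f : S.carrier → T.carrier)
    (hf : Function.Injective f)
    (hpay : ∀ w : T.carrier → Bool, sideLe s (S.payoff (w ∘ f)) (T.payoff w))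
    {p : S.Position} {q : T.Position} (hpq : ∀ c, CellLe s (p c) (q (f c))) :
    SLe s (S.positionValue p) (T.positionValue q) :=
  positionValue_sLe_of_compatible S T f hf (fun w _ => hpay w) hpq

/-- An additional move does not hurt. -/
theorem sLe_color (S : SetColoringGame A) (s : Bool) (p : S.Position) {c : S.carrier} :
    SLe s (S.positionValue p) (S.positionValue (S.color p c s)) := by
  refine positionValue_sLe S S id Function.injective_id (fun w => sideLe_refl _ _) fun d => ?_
  by_cases h : d = c
  · rw [h, id, color_self]
    exact .inr (.inr rfl)
  · rw [id, color_of_ne _ _ _ h]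
    exact .inl rfl

/-- Having to move is no disadvantage. -/
theorem sTri_of_sLe (S : SetColoringGame A) {s : Bool} {K : Game A} {p : S.Position}
    (h : SLe s K (S.positionValue p)) : STri s K (S.positionValue p) := by
  by_cases hp : ∃ c, p c = none
  · obtain ⟨c, hc⟩ := hp
    exact sTri_of_reply_right (S.mem_opts s hc) (h.trans (S.sLe_color s p))
  · push Not at hp
    obtain ⟨w, rfl⟩ := S.exists_eq_some hp
    rw [positionValue_some] at h ⊢
    exact (sLe_iff.1 h).2.2 (.inr ⟨_, rfl⟩)

theorem sTri_of_move (S : SetColoringGame A) {s : Bool} {K : Game A} {p : S.Position}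
    {c : S.carrier} (hc : p c = none) (h : SLe s K (S.positionValue (S.color p c s))) :
    STri s K (S.positionValue p) :=
  sTri_of_reply_right (S.mem_opts s hc) h

/-- To prove that `K` is at most `S.positionValue p` for the player `s`, it is enough to consider
the moves of the opponent, and the case that there are none. -/
theorem sLe_positionValue (S : SetColoringGame A) {s : Bool} {K : Game A} {p : S.Position}
    (h₁ : ∀ X ∈ opts s K, STri s X (S.positionValue p))
    (h₂ : ∀ c, p c = none → STri s K (S.positionValue (S.color p c !s)))
    (h₃ : K.IsAtomic ∨ (∀ c, p c ≠ none) → STri s K (S.positionValue p)) :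
    SLe s K (S.positionValue p) := by
  refine sLe_iff.2 ⟨h₁, fun X hX => ?_, fun h => h₃ (h.imp_right fun h => ?_)⟩
  · rw [opts_positionValue] at hX
    obtain ⟨c, hc, rfl⟩ := hX
    exact h₂ c hc
  · exact S.ne_none_of_isAtomic h

end SetColoringGame

/-! ### Switches -/

/-- The outcomes of a switch: a win for one of the players, or one of the symbols of one of the
players. -/
inductive Outcome (ι : Type) : Type
  | ext (b : Bool)
  | sym (t : Bool) (i : ι)

namespace Outcome

variable {ι : Type}

/-- The order on outcomes from the side of the player `s`: a win for `s` is the largest, a loss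
the smallest outcome, and distinct symbols are incomparable. -/
def SideLe (s : Bool) (x y : Outcome ι) : Prop := x = y ∨ x = ext !s ∨ y = ext s

theorem SideLe.refl (s : Bool) (x : Outcome ι) : SideLe s x x := .inl rfl

theorem SideLe.trans {s : Bool} {x y z : Outcome ι} (h : SideLe s x y) (h' : SideLe s y z) :
    SideLe s x z := by
  obtain rfl | rfl | rfl := h
  · exact h'
  · exact .inr (.inl rfl)
  · obtain rfl | h' | rfl := h'
    · exact .inr (.inr rfl)
    · cases s <;> simp at h'
    · exact .inr (.inr rfl)

theorem sideLe_not {s : Bool} {x y : Outcome ι} : SideLe (!s) x y ↔ SideLe s y x := by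
  simp only [SideLe, Bool.not_not]
  constructor <;> rintro (h | h | h) <;> simp [h]

theorem sideLe_ext {s : Bool} {x : Outcome ι} : SideLe s x (ext s) := .inr (.inr rfl)

theorem eq_of_ext_sideLe {s : Bool} {x : Outcome ι} (h : SideLe s (ext s) x) : x = ext s := by
  obtain rfl | h | h := h
  · rfl
  · cases s <;> simp at h
  · exact h

theorem eq_of_sym_sideLe {s t : Bool} {i : ι} {x : Outcome ι} (h : SideLe s (sym t i) x) :
    x = sym t i ∨ x = ext s := by
  obtain h | h | h := h
  · exact .inl h.symm
  · simp at h
  · exact .inr h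

end Outcome

section Switch

variable {E ι : Type} [DecidableEq E]

/-- The position obtained by coloring a cell. -/
def put (q : E → Option Bool) (c : E) (x : Bool) : E → Option Bool := Function.update q c (some x)

@[simp] theorem put_self (q : E → Option Bool) (c : E) (x : Bool) : put q c x c = some x :=
  Function.update_self ..

theorem put_of_ne (q : E → Option Bool) {c d : E} (x : Bool) (h : d ≠ c) : put q c x d = q d :=
  Function.update_of_ne h ..

/-- The player `s` can move to a position that satisfies `P`. -/
def CanMoveTo (s : Bool) (P : (E → Option Bool) → Prop) (q : E → Option Bool) : Prop :=
  ∃ c, q c = none ∧ P (put q c s)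

/-- The player `s`, whose turn it is, can pass or move to a position that satisfies `P`. -/
def CanReach (s : Bool) (P : (E → Option Bool) → Prop) (q : E → Option Bool) : Prop :=
  P q ∨ CanMoveTo s P q

/-- How the player `s` plays in a switch with the outcome function `φ`.

* In a position satisfying `holds t`, with the opponent to move, `s` secures the outcome `t`.
* In a position satisfying `winning`, with the opponent to move, `s` threatens to win, and the
  opponent can at best secure one of their own symbols.
* In a position satisfying `calm`, with the opponent to move, `s` can choose any of the symbols in
  `avail`, and can also make a move to a winning position. If the opponent moves, `s` can secure
  a good symbol or again reach such a position, unless the opponent has chosen a symbol. -/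
structure SwitchStrategy (φ : (E → Bool) → Outcome ι) (s : Bool) (avail good : Set ι) where
  /-- The positions in which an outcome is secured. -/
  holds : Outcome ι → (E → Option Bool) → Prop
  /-- The positions in which `s` threatens to win. -/
  winning : (E → Option Bool) → Prop
  /-- The positions in which `s` still has all options. -/
  calm : (E → Option Bool) → Prop
  holds_full : ∀ t (w : E → Bool), holds t (fun c => some (w c)) → Outcome.SideLe s t (φ w)
  holds_move : ∀ t q c, holds t q → q c = none → CanReach s (holds t) (put q c !s)
  winning_threat : ∀ q, winning q → CanReach s (holds (.ext s)) q
  winning_move : ∀ q c, winning q → q c = none → CanReach s (holds (.ext s)) (put q c !s) ∨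
    (∃ j, holds (.sym (!s) j) (put q c !s)) ∨ CanMoveTo s winning (put q c !s)
  calm_choose : ∀ q, calm q → ∀ i ∈ avail, CanReach s (holds (.sym s i)) q
  calm_win : ∀ q, calm q → CanMoveTo s winning q
  calm_move : ∀ q c, calm q → q c = none →
    (∃ i ∈ good, CanReach s (holds (.sym s i)) (put q c !s)) ∨
    (∃ j, holds (.sym (!s) j) (put q c !s)) ∨ CanMoveTo s calm (put q c !s) ∨
    CanMoveTo s winning (put q c !s)
  calm_start : calm fun _ => none

end Switch

/-! ### Realizing a game by a switch -/

section Realize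

variable {A : Type*} [PartialOrder A] [BoundedOrder A] {E ι Z : Type}

/-- The payoff function on the remaining cells that belongs to an outcome of the switch. -/
def outcomePayoff (pay : Bool → ι → (Z → Bool) →o A) : Outcome ι → (Z → Bool) →o A
  | .ext b => OrderHom.const _ (if b then ⊤ else ⊥)
  | .sym t i => pay t i

theorem outcomePayoff_sideLe (pay : Bool → ι → (Z → Bool) →o A) {s : Bool} {x y : Outcome ι}
    (h : Outcome.SideLe s x y) (z : Z → Bool) :
    sideLe s (outcomePayoff pay x z) (outcomePayoff pay y z) := by
  obtain rfl | rfl | rfl := h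
  · exact sideLe_refl _ _
  · cases s <;> simp [sideLe, outcomePayoff]
  · cases s <;> simp [sideLe, outcomePayoff]

/-- The set coloring game on the remaining cells that belongs to an outcome of the switch. -/
abbrev outcomeGame [Finite Z] (pay : Bool → ι → (Z → Bool) →o A) (x : Outcome ι) :
    SetColoringGame A where
  carrier := Z
  finite_carrier := inferInstance
  payoff := outcomePayoff pay x

/-- The set coloring game in which a switch decides about the payoff function that is used on the
remaining cells. -/
abbrev switchGame [Finite E] [Finite Z] (φ : (E → Bool) → Outcome ι)
    (hφ : ∀ v w, v ≤ w → Outcome.SideLe true (φ v) (φ w)) (pay : Bool → ι → (Z → Bool) →o A) :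
    SetColoringGame A where
  carrier := E ⊕ Z
  finite_carrier := inferInstance
  payoff :=
    { toFun := fun w => outcomePayoff pay (φ (w ∘ Sum.inl)) (w ∘ Sum.inr)
      monotone' := fun _ _ h =>
        le_trans ((outcomePayoff pay _).monotone fun c => h (Sum.inr c))
          (outcomePayoff_sideLe (s := true) pay (hφ _ _ fun c => h (Sum.inl c)) _) }

/-- With a constant winning payoff, `s` can use up the empty cells. When none is left, the opponent
has to move in `K`, which is possible because option sets of composite games are non-empty, until
`K` is atomic and is compared with the extremal element. -/
theorem sLe_outcomeGame_ext [Finite Z] (pay : Bool → ι → (Z → Bool) →o A) (s : Bool) (K : Game A)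
    (z : Z → Option Bool) :
    SLe s K ((outcomeGame pay (.ext s)).positionValue z) := by
  set S := outcomeGame pay (.ext s)
  suffices H : ∀ n, ∀ K : Game A, ∀ z : S.Position, S.emptyCount z = n →
      SLe s K (S.positionValue z) ∧ STri s K (S.positionValue z) from (H _ K z rfl).1
  intro n
  induction n using Nat.strong_induction_on with | _ n ihn
  intro K
  induction K using option_induction with | _ K ihK
  intro z hz
  have tri : STri s K (S.positionValue z) := by
    by_cases hp : ∃ c, z c = none
    · obtain ⟨c, hc⟩ := hp
      exact S.sTri_of_move hc (ihn _ (hz ▸ S.emptyCount_color_lt hc s) K _ rfl).1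
    obtain ⟨a, rfl⟩ | hK := isAtomic_or_opts_nonempty K
    · push Not at hp
      obtain ⟨w, rfl⟩ := S.exists_eq_some hp
      rw [S.positionValue_some]
      refine sTri_atom ?_
      have : S.payoff w = if s then ⊤ else ⊥ := rfl
      cases s <;> simp [sideLe, this]
    · obtain ⟨X, hX⟩ := hK (!s)
      exact sTri_of_reply_left hX (ihK _ X hX z hz).1
  exact ⟨S.sLe_positionValue (fun X hX => (ihK _ X hX z hz).2)
    (fun c hc => (ihn _ (hz ▸ S.emptyCount_color_lt hc (!s)) K _ rfl).2) fun _ => tri, tri⟩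

variable [DecidableEq E] [Finite E] [Finite Z] {φ : (E → Bool) → Outcome ι}
  {hφ : ∀ v w, v ≤ w → Outcome.SideLe true (φ v) (φ w)} {pay : Bool → ι → (Z → Bool) →o A}
  {s : Bool} {avail good : Set ι}

theorem switchGame_color_inl (q : E → Option Bool) (z : Z → Option Bool) (c : E) (x : Bool) :
    (switchGame φ hφ pay).color (Sum.elim q z) (Sum.inl c) x = Sum.elim (put q c x) z := by
  funext d
  by_cases hd : d = Sum.inl c
  · subst hd
    exact (SetColoringGame.color_self (switchGame φ hφ pay) _ _ _).trans
      (put_self q c x).symm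
  · refine (SetColoringGame.color_of_ne (switchGame φ hφ pay) _ _ hd).trans ?_
    obtain d | d := d
    · exact (put_of_ne q x fun h => hd (congrArg Sum.inl h)).symm
    · rfl

theorem switchGame_color_inr (q : E → Option Bool) (z : Z → Option Bool) (c : Z) (x : Bool)
    (o : Outcome ι) :
    (switchGame φ hφ pay).color (Sum.elim q z) (Sum.inr c) x =
      Sum.elim q ((outcomeGame pay o).color z c x) := by
  funext d
  by_cases hd : d = Sum.inr c
  · subst hd
    exact (SetColoringGame.color_self (switchGame φ hφ pay) _ _ _).trans
      ((outcomeGame pay o).color_self z c x).symm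
  · refine (SetColoringGame.color_of_ne (switchGame φ hφ pay) _ _ hd).trans ?_
    obtain d | d := d
    · rfl
    · exact ((outcomeGame pay o).color_of_ne z x fun h => hd (congrArg Sum.inr h)).symm

namespace SwitchStrategy

variable (σ : SwitchStrategy φ s avail good)

/-- The hypothesis on `w` forces the color `s` on all empty cells of `q`. The position can be played
out with `s` following the strategy, and `w` remains at least as good for `s` as the positions that
arise. -/
theorem sideLe_of_holds (hφ : ∀ v w, v ≤ w → Outcome.SideLe true (φ v) (φ w))
    {t : Outcome ι} (n : ℕ) (q : E → Option Bool)
    (hn : {c | q c = none}.ncard = n) (hq : σ.holds t q) (w : E → Bool)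
    (hqw : ∀ c, CellLe s (q c) (some (w c))) : Outcome.SideLe s t (φ w) := by
  induction n using Nat.strong_induction_on generalizing q with | _ n ih
  by_cases h : ∃ c, q c = none
  · obtain ⟨c, hc⟩ := h
    have hlt (q' : E → Option Bool) (d : E) (hd : q' d = none) (x : Bool) :
        {c | put q' d x c = none}.ncard < {c | q' c = none}.ncard := by
      refine Set.ncard_lt_ncard ⟨fun e he => ?_, fun h => ?_⟩ (Set.toFinite _)
      · by_cases hed : e = d
        · exact hed ▸ hd
        · exact (put_of_ne q' x hed).symm.trans he
      · have := h hd
        simp at this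
    have hput : ∀ e, CellLe s (put q c (!s) e) (some (w e)) := fun e => by
      by_cases hec : e = c
      · rw [hec, put_self]
        exact .inr (.inl rfl)
      · rw [put_of_ne _ _ hec]
        exact hqw e
    obtain h | ⟨d, hd, h⟩ := σ.holds_move t q c hq hc
    · exact ih _ (hn ▸ hlt q c hc _) _ rfl h hput
    · refine ih _ (hn ▸ (hlt _ d hd _).trans (hlt q c hc _)) _ rfl h fun e => ?_
      by_cases hed : e = d
      · have := hput d
        rw [hd] at this
        rw [hed, put_self]
        obtain h' | h' | h' := this
        · simp at h'
        · simp at h'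
        · exact .inl h'.symm
      · rw [put_of_ne _ _ hed]
        exact hput e
  · push Not at h
    choose v hv using fun c => Option.ne_none_iff_exists'.1 (h c)
    obtain rfl : q = fun c => some (v c) := funext hv
    refine (σ.holds_full t v hq).trans ?_
    cases s
    · refine Outcome.sideLe_not.2 (hφ _ _ fun c => ?_)
      have := hqw c
      simp only [CellLe, Option.some.injEq] at this
      revert this
      cases v c <;> cases w c <;> simp
    · refine hφ _ _ fun c => ?_
      have := hqw c
      simp only [CellLe, Option.some.injEq] at this
      revert this
      cases v c <;> cases w c <;> simp

/-- The player `s` may be forced to make spare moves in the switch, so the actual position `q'` can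
be better than the position `q` that the strategy has in mind. Moves in `Z` are copied, moves in the
switch are answered according to `q`, and a reply that `q'` already contains becomes a pass. -/
theorem holds_sLe_aux {t : Outcome ι} (n : ℕ) (q q' : E → Option Bool) (z : Z → Option Bool)
    (hn : (switchGame φ hφ pay).emptyCount (Sum.elim q' z) = n) (hq : σ.holds t q)
    (hqq : ∀ c, CellLe s (q c) (q' c)) :
    SLe s ((outcomeGame pay t).positionValue z)
      ((switchGame φ hφ pay).positionValue (Sum.elim q' z)) := by
  induction n using Nat.strong_induction_on generalizing q q' z with | _ n ih
  let S := switchGame φ hφ pay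
  let T := outcomeGame pay t
  have lt_inl (q' : E → Option Bool) (c : E) (hc : q' c = none) (x : Bool) :
      S.emptyCount (Sum.elim (put q' c x) z) < S.emptyCount (Sum.elim q' z) := by
    have := S.emptyCount_color_lt (p := Sum.elim q' z) (c := Sum.inl c) hc x
    rwa [switchGame_color_inl] at this
  have put_le {q q' : E → Option Bool} (h : ∀ c, CellLe s (q c) (q' c)) (c : E) (x : Bool) :
      ∀ d, CellLe s (put q c x d) (put q' c x d) := fun d => by
    by_cases hd : d = c
    · rw [hd, put_self, put_self]
      exact .inl rfl
    · rw [put_of_ne _ _ hd, put_of_ne _ _ hd]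
      exact h d
  have moveE (c : E) (hc : q' c = none) :
      STri s (T.positionValue z) (S.positionValue (Sum.elim (put q' c !s) z)) := by
    have hlt := hn ▸ lt_inl q' c hc !s
    obtain hqc | hqc | hqc := hqq c
    · rw [hc] at hqc
      have hle := put_le hqq c !s
      obtain h | ⟨d, hd, h⟩ := σ.holds_move t q c hq hqc
      · exact S.sTri_of_sLe (ih _ hlt _ _ _ rfl h hle)
      · have hle' := hle d
        rw [hd] at hle'
        have hle'' := put_le hle d s
        obtain h' | h' | h' := hle'
        · refine S.sTri_of_move (c := Sum.inl d) h'.symm ?_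
          rw [switchGame_color_inl]
          exact ih _ ((lt_inl _ d h'.symm s).trans hlt) _ _ _ rfl h hle''
        · simp at h'
        · refine S.sTri_of_sLe (ih _ hlt _ _ _ rfl h ?_)
          rwa [show put (put q' c !s) d s = put q' c !s by
            unfold put at h' ⊢; rw [← h', Function.update_eq_self]] at hle''
    · refine S.sTri_of_sLe (ih _ hlt _ _ _ rfl hq fun d => ?_)
      by_cases hd : d = c
      · rw [hd, put_self]
        exact .inl hqc
      · rw [put_of_ne _ _ hd]
        exact hqq d
    · simp [hc] at hqc
  have moveZ (c : Z) (hc : z c = none) (x : Bool) :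
      SLe s (T.positionValue (T.color z c x))
        (S.positionValue (S.color (Sum.elim q' z) (Sum.inr c) x)) := by
    have := S.emptyCount_color_lt (p := Sum.elim q' z) (c := Sum.inr c) hc x
    rw [switchGame_color_inr (o := t)] at this ⊢
    exact ih _ (hn ▸ this) _ _ _ rfl hq hqq
  refine S.sLe_positionValue (fun X hX => ?_) (fun c hc => ?_) fun h => ?_
  · obtain ⟨c, hc, rfl⟩ := (T.opts_positionValue s z).le hX
    exact S.sTri_of_move (c := Sum.inr c) hc (moveZ c hc s)
  · obtain c | c := c
    · rw [switchGame_color_inl]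
      exact moveE c hc
    · exact sTri_of_reply_left (T.mem_opts (!s) hc) (moveZ c hc (!s))
  · have hz (c : Z) : z c ≠ none := h.elim (fun h => T.ne_none_of_isAtomic h c) fun h => h (Sum.inr c)
    by_cases hq' : ∃ c, q' c = none
    -- All of `Z` is colored but the switch is not: a spare move there changes `q'` and leaves `q`
    -- alone.
    · obtain ⟨c, hc⟩ := hq'
      refine S.sTri_of_move (c := Sum.inl c) hc ?_
      rw [switchGame_color_inl]
      refine ih _ (hn ▸ lt_inl q' c hc s) _ _ _ rfl hq fun d => ?_
      by_cases hd : d = c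
      · rw [hd, put_self]
        exact .inr (.inr rfl)
      · rw [put_of_ne _ _ hd]
        exact hqq d
    · push Not at hq'
      choose v hv using fun c => Option.ne_none_iff_exists'.1 (hq' c)
      obtain rfl : q' = fun c => some (v c) := funext hv
      obtain ⟨w, rfl⟩ := T.exists_eq_some hz
      have : Sum.elim (fun c => some (v c)) (fun c => some (w c)) =
          fun c => some ((Sum.elim v w : E ⊕ Z → Bool) c) := by
        ext c
        cases c <;> rfl
      have hS := (congrArg S.positionValue this).trans (S.positionValue_some _)
      have hT := T.positionValue_some w
      refine Eq.mpr (congrArg₂ (STri s) hT hS) ?_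
      exact sTri_atom (outcomePayoff_sideLe pay (σ.sideLe_of_holds hφ _ q rfl hq v hqq) w)

/-- If `s` has secured an outcome, then the remaining cells decide. -/
theorem holds_sLe {t : Outcome ι} {q : E → Option Bool} (z : Z → Option Bool)
    (hq : σ.holds t q) :
    SLe s ((outcomeGame pay t).positionValue z)
      ((switchGame φ hφ pay).positionValue (Sum.elim q z)) :=
  σ.holds_sLe_aux _ q q z rfl hq fun _ => .inl rfl

theorem sTri_of_canReach {t : Outcome ι} {q : E → Option Bool} (z : Z → Option Bool)
    (hq : CanReach s (σ.holds t) q) :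
    STri s ((outcomeGame pay t).positionValue z)
      ((switchGame φ hφ pay).positionValue (Sum.elim q z)) := by
  obtain h | ⟨c, hc, h⟩ := hq
  · exact (switchGame φ hφ pay).sTri_of_sLe (σ.holds_sLe z h)
  · refine (switchGame φ hφ pay).sTri_of_move (c := Sum.inl c) hc ?_
    rw [switchGame_color_inl]
    exact σ.holds_sLe z h

theorem sTri_of_canReach_ext {K : Game A} {q : E → Option Bool} (z : Z → Option Bool)
    (hq : CanReach s (σ.holds (.ext s)) q) :
    STri s K ((switchGame φ hφ pay).positionValue (Sum.elim q z)) :=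
  (sLe_outcomeGame_ext pay s K z).trans_sTri (σ.sTri_of_canReach z hq)

theorem sTri_of_canMoveTo {P : (E → Option Bool) → Prop} {K : Game A} {q : E → Option Bool}
    {z : Z → Option Bool} (hq : CanMoveTo s P q)
    (h : ∀ c, q c = none → P (put q c s) →
      SLe s K ((switchGame φ hφ pay).positionValue (Sum.elim (put q c s) z))) :
    STri s K ((switchGame φ hφ pay).positionValue (Sum.elim q z)) := by
  obtain ⟨c, hc, hP⟩ := hq
  refine (switchGame φ hφ pay).sTri_of_move (c := Sum.inl c) hc ?_
  rw [switchGame_color_inl]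
  exact h c hc hP

/-- A position with nothing but empty cells. -/
abbrev emptyPosition (Z : Type) : Z → Option Bool := fun _ => none

theorem emptyCount_put_lt {q : E → Option Bool} {c : E} (hc : q c = none) (x : Bool)
    (z : Z → Option Bool) :
    (switchGame φ hφ pay).emptyCount (Sum.elim (put q c x) z) <
      (switchGame φ hφ pay).emptyCount (Sum.elim q z) := by
  have := (switchGame φ hφ pay).emptyCount_color_lt (p := Sum.elim q z) (c := Sum.inl c) hc x
  rwa [switchGame_color_inl] at this

/-- A player with a pending win satisfies `⊲` against every game, so the opponent must react inside
the switch. The best reaction is to secure a symbol of their own, which `h_theirs` covers. -/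
theorem winning_sLe_aux {G : Game A}
    (h_theirs : ∀ j, STri s G ((outcomeGame pay (.sym (!s) j)).positionValue (emptyPosition Z)))
    (n : ℕ) (q : E → Option Bool)
    (hn : (switchGame φ hφ pay).emptyCount (Sum.elim q (emptyPosition Z)) = n)
    (hq : σ.winning q) :
    SLe s G ((switchGame φ hφ pay).positionValue (Sum.elim q (emptyPosition Z))) := by
  induction n using Nat.strong_induction_on generalizing q with | _ n ih
  have tri {K : Game A} {z : Z → Option Bool} :
      STri s K ((switchGame φ hφ pay).positionValue (Sum.elim q z)) :=
    σ.sTri_of_canReach_ext z (σ.winning_threat q hq)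
  refine (switchGame φ hφ pay).sLe_positionValue (fun X _ => tri) ?_ fun _ => tri
  rintro (c | c) hc
  · rw [switchGame_color_inl]
    obtain h | ⟨j, h⟩ | h := σ.winning_move q c hq hc
    · exact σ.sTri_of_canReach_ext _ h
    · exact (h_theirs j).trans_sLe (σ.holds_sLe _ h)
    · refine sTri_of_canMoveTo h fun d hd hw => ih _ ?_ _ rfl hw
      have h₁ := emptyCount_put_lt (φ := φ) (hφ := hφ) (pay := pay) hd s (emptyPosition Z)
      have h₂ := emptyCount_put_lt (φ := φ) (hφ := hφ) (pay := pay) hc (!s) (emptyPosition Z)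
      exact hn ▸ h₁.trans h₂
  · rw [switchGame_color_inr (o := .ext s)]
    exact tri

/-- Each hypothesis answers one kind of move: `h_mine` a move of `s` in `G`, `h_theirs` the choice
of a symbol by the opponent, `h_good` an evasive move of the opponent in the switch, and `h_cell` a
move of the opponent outside the switch. Other moves of the opponent are answered by returning to a
calm position or by going to a winning one. -/
theorem calm_sLe_aux {G : Game A} (hG : ¬ G.IsAtomic)
    (h_mine : ∀ K ∈ opts s G, ∃ i ∈ avail,
      SLe s K ((outcomeGame pay (.sym s i)).positionValue (emptyPosition Z)))
    (h_theirs : ∀ j, STri s G ((outcomeGame pay (.sym (!s) j)).positionValue (emptyPosition Z)))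
    (h_good : ∀ i ∈ good,
      SLe s G ((outcomeGame pay (.sym s i)).positionValue (emptyPosition Z)))
    (h_cell : ∀ c : Z, ∃ i ∈ avail, SLe s G ((outcomeGame pay (.sym s i)).positionValue
      ((outcomeGame pay (.sym s i)).color (emptyPosition Z) c !s)))
    (n : ℕ) (q : E → Option Bool)
    (hn : (switchGame φ hφ pay).emptyCount (Sum.elim q (emptyPosition Z)) = n)
    (hq : σ.calm q) :
    SLe s G ((switchGame φ hφ pay).positionValue (Sum.elim q (emptyPosition Z))) := by
  induction n using Nat.strong_induction_on generalizing q with | _ n ih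
  refine (switchGame φ hφ pay).sLe_positionValue (fun X hX => ?_) ?_ ?_
  · obtain ⟨i, hi, h⟩ := h_mine X hX
    exact h.trans_sTri (σ.sTri_of_canReach _ (σ.calm_choose q hq i hi))
  · rintro (c | c) hc
    · rw [switchGame_color_inl]
      obtain ⟨i, hi, h⟩ | ⟨j, h⟩ | h | h := σ.calm_move q c hq hc
      · exact (h_good i hi).trans_sTri (σ.sTri_of_canReach _ h)
      · exact (h_theirs j).trans_sLe (σ.holds_sLe _ h)
      · refine sTri_of_canMoveTo h fun d hd hw => ih _ ?_ _ rfl hw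
        have h₁ := emptyCount_put_lt (φ := φ) (hφ := hφ) (pay := pay) hd s (emptyPosition Z)
        have h₂ := emptyCount_put_lt (φ := φ) (hφ := hφ) (pay := pay) hc (!s) (emptyPosition Z)
        exact hn ▸ h₁.trans h₂
      · exact sTri_of_canMoveTo h fun d hd hw => σ.winning_sLe_aux h_theirs _ _ rfl hw
    · obtain ⟨i, hi, h⟩ := h_cell c
      rw [switchGame_color_inr (o := .sym s i)]
      exact h.trans_sTri (σ.sTri_of_canReach _ (σ.calm_choose q hq i hi))
  · rintro (h | h)
    · exact (hG h).elim
    · obtain ⟨c, hc, -⟩ := σ.calm_win q hq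
      exact (h (Sum.inl c) hc).elim

/-- One half of the realization of a game by a switch. -/
theorem sLe_switchGame_value (σ : SwitchStrategy φ s avail good) {G : Game A} (hG : ¬ G.IsAtomic)
    (h_mine : ∀ K ∈ opts s G, ∃ i ∈ avail, SLe s K (outcomeGame pay (.sym s i)).value)
    (h_theirs : ∀ j, STri s G (outcomeGame pay (.sym (!s) j)).value)
    (h_good : ∀ i ∈ good, SLe s G (outcomeGame pay (.sym s i)).value)
    (h_cell : ∀ c : Z, ∃ i ∈ avail, SLe s G ((outcomeGame pay (.sym s i)).positionValue
      ((outcomeGame pay (.sym s i)).color (emptyPosition Z) c !s))) :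
    SLe s G (switchGame φ hφ pay).value := by
  have := σ.calm_sLe_aux (hφ := hφ) hG h_mine h_theirs h_good h_cell _ _ rfl σ.calm_start
  rwa [show Sum.elim (fun _ => none) (emptyPosition Z) = fun _ : E ⊕ Z => (none : Option Bool) by
    ext c; cases c <;> rfl] at this

end SwitchStrategy

end Realize

/-! ### Doubling the number of symbols of a switch -/

section PairOutcome

variable {ι κ : Type}

/-- The outcome `x` of a switch, modified by two additional cells for each player. A player who
colors both of their cells wins. Otherwise, they contribute an additional bit to the symbols of
their player, unless the opponent has colored both of them. -/
def pairOutcome (mk : ι → Bool → κ) (x : Outcome ι) (u : Bool → Bool → Bool) : Outcome κ :=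
  if u true false ∧ u true true then .ext true
  else if ¬ u false false ∧ ¬ u false true then .ext false
  else match x with
    | .ext b => .ext b
    | .sym t i => if u t false = u t true then .ext !t else .sym t (mk i (u t false))

variable (mk : ι → Bool → κ) {s : Bool} {u : Bool → Bool → Bool}

/-- Once the wins by a complete pair are set aside, the pair belonging to a symbol either agrees in
`u` and `v`, or has one color in one of them. In the latter case the resulting win is on the correct
side of the order. -/
theorem pairOutcome_mono {x y : Outcome ι} (hxy : Outcome.SideLe true x y)
    {u v : Bool → Bool → Bool} (huv : ∀ t k, u t k ≤ v t k) :
    Outcome.SideLe true (pairOutcome mk x u) (pairOutcome mk y v) := by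
  have h (t k : Bool) : u t k = true → v t k = true := fun h =>
    Bool.le_iff_imp.1 (huv t k) h
  have h₁ := h true false
  have h₂ := h true true
  have h₃ := h false false
  have h₄ := h false true
  unfold pairOutcome
  by_cases hb : v true false ∧ v true true
  · rw [if_pos hb]
    exact Outcome.sideLe_ext
  by_cases ha : ¬ u false false ∧ ¬ u false true
  · rw [if_neg (by tauto), if_pos ha]
    exact .inr (.inl rfl)
  rw [if_neg (by tauto), if_neg ha, if_neg hb, if_neg (by tauto)]
  obtain rfl | rfl | rfl := hxy
  · obtain b | ⟨_ | _, i⟩ := x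
    · exact .refl _ _
    · by_cases hv : v false false = v false true
      · simp [hv, Outcome.sideLe_ext]
      · have : u false false = v false false ∧ u false true = v false true := by
          revert h₃ h₄ ha hv
          cases u false false <;> cases u false true <;> cases v false false <;>
            cases v false true <;> simp
        simp only [this.1, this.2]
        exact .refl _ _
    · by_cases hu : u true false = u true true
      · simp [hu, Outcome.SideLe]
      · have : u true false = v true false ∧ u true true = v true true := by
          revert h₁ h₂ hb hu
          cases u true false <;> cases u true true <;> cases v true false <;>
            cases v true true <;> simp
        simp only [this.1, this.2]
        exact .refl _ _
  · exact .inr (.inl rfl)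
  · exact .inr (.inr rfl)

theorem pairOutcome_of_own (h : ∀ k, u s k = s) (h' : ∃ k, u (!s) k = s) (x : Outcome ι) :
    pairOutcome mk x u = .ext s := by
  have h₁ := h true
  have h₂ := h false
  obtain ⟨k, hk⟩ := h'
  cases s <;> cases k <;> simp_all [pairOutcome]

theorem pairOutcome_ext (h' : ∃ k, u (!s) k = s) :
    pairOutcome mk (.ext s) u = .ext s := by
  obtain ⟨k, hk⟩ := h'
  cases s <;> cases k <;> simp_all [pairOutcome]

theorem pairOutcome_theirs_of_all (h : ∀ k, u (!s) k = s) (j : ι) :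
    pairOutcome mk (.sym (!s) j) u = .ext s := by
  have h₁ := h true
  have h₂ := h false
  cases s <;> simp_all [pairOutcome]

theorem sideLe_pairOutcome_mine (h' : ∃ k, u (!s) k = s) {b : Bool} (h₁ : u s false = b)
    (h₂ : u s true = !b) (i : ι) :
    Outcome.SideLe s (.sym s (mk i b)) (pairOutcome mk (.sym s i) u) := by
  obtain ⟨k, hk⟩ := h'
  cases s <;> cases k <;> cases b <;> simp_all [pairOutcome, Outcome.SideLe]

theorem sideLe_pairOutcome_theirs {b : Bool} (h₁ : u (!s) false = b)
    (h₂ : u (!s) true = !b) (j : ι) :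
    Outcome.SideLe s (.sym (!s) (mk j b)) (pairOutcome mk (.sym (!s) j) u) := by
  by_cases h : u s false = s ∧ u s true = s
  · obtain ⟨h₃, h₄⟩ := h
    cases s <;> cases b <;> simp_all [pairOutcome, Outcome.SideLe]
  · cases s <;> cases b <;> simp_all [pairOutcome, Outcome.SideLe]

end PairOutcome

section Extend

variable {E ι κ : Type} [DecidableEq E]

/-- The switch `φ`, with two additional cells for each player. -/
def extendSwitch (φ : (E → Bool) → Outcome ι) (mk : ι → Bool → κ)
    (w : E ⊕ Bool × Bool → Bool) : Outcome κ :=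
  pairOutcome mk (φ fun c => w (.inl c)) fun t k => w (.inr (t, k))

/-- A predicate on positions of an extended switch, in terms of the positions of the switch, of
the additional cells of `s` and of the additional cells of the opponent. -/
def PairView (s : Bool)
    (P : (E → Option Bool) → (Bool → Option Bool) → (Bool → Option Bool) → Prop)
    (q : E ⊕ Bool × Bool → Option Bool) : Prop :=
  P (fun c => q (.inl c)) (fun k => q (.inr (s, k))) (fun k => q (.inr (!s, k)))

/-- The version of `CanMoveTo` that belongs to `PairView`. -/
def PairCanMoveTo (s : Bool)
    (P : (E → Option Bool) → (Bool → Option Bool) → (Bool → Option Bool) → Prop)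
    (q : E → Option Bool) (z w : Bool → Option Bool) : Prop :=
  (∃ c, q c = none ∧ P (put q c s) z w) ∨ (∃ k, z k = none ∧ P q (put z k s) w) ∨
    ∃ k, w k = none ∧ P q z (put w k s)

variable {s : Bool}
  {P R : (E → Option Bool) → (Bool → Option Bool) → (Bool → Option Bool) → Prop}

theorem pairView_put_inl {q : E ⊕ Bool × Bool → Option Bool} {c : E} {x : Bool} :
    PairView s P (put q (.inl c) x) ↔ P (put (fun c => q (.inl c)) c x)
      (fun k => q (.inr (s, k))) (fun k => q (.inr (!s, k))) := by
  have h : (fun d => put q (.inl c) x (.inl d)) = put (fun c => q (.inl c)) c x := by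
    funext d
    by_cases hd : d = c
    · rw [hd, put_self, put_self]
    · rw [put_of_ne _ _ hd, put_of_ne _ _ (by simpa using hd)]
  unfold PairView
  rw [h]
  simp [put_of_ne]

theorem pairView_put_own {q : E ⊕ Bool × Bool → Option Bool} {k : Bool} {x : Bool} :
    PairView s P (put q (.inr (s, k)) x) ↔ P (fun c => q (.inl c))
      (put (fun k => q (.inr (s, k))) k x) (fun k => q (.inr (!s, k))) := by
  have h : (fun d => put q (.inr (s, k)) x (.inr (s, d))) = put (fun k => q (.inr (s, k))) k x := by
    funext d
    by_cases hd : d = k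
    · rw [hd, put_self, put_self]
    · rw [put_of_ne _ _ hd, put_of_ne _ _ (by simpa using hd)]
  unfold PairView
  rw [h]
  simp [put_of_ne]

theorem pairView_put_opp {q : E ⊕ Bool × Bool → Option Bool} {k : Bool} {x : Bool} :
    PairView s P (put q (.inr (!s, k)) x) ↔ P (fun c => q (.inl c))
      (fun k => q (.inr (s, k))) (put (fun k => q (.inr (!s, k))) k x) := by
  have h : (fun d => put q (.inr (!s, k)) x (.inr (!s, d))) =
      put (fun k => q (.inr (!s, k))) k x := by
    funext d
    by_cases hd : d = k
    · rw [hd, put_self, put_self]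
    · rw [put_of_ne _ _ hd, put_of_ne _ _ (by simpa using hd)]
  unfold PairView
  rw [h]
  simp [put_of_ne]

theorem canMoveTo_pairView {q : E ⊕ Bool × Bool → Option Bool}
    (h : PairView s (PairCanMoveTo s P) q) : CanMoveTo s (PairView s P) q := by
  obtain ⟨c, hc, h⟩ | ⟨k, hk, h⟩ | ⟨k, hk, h⟩ := h
  · exact ⟨.inl c, hc, pairView_put_inl.2 h⟩
  · exact ⟨.inr (s, k), hk, pairView_put_own.2 h⟩
  · exact ⟨.inr (!s, k), hk, pairView_put_opp.2 h⟩

/-- A move of the opponent concerns the old cells, the pair of `s`, or the pair of the opponent.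
Every clause of `extend` about such moves is checked by these three cases. -/
theorem pairView_move (hE : ∀ q z w c, P q z w → q c = none → R (put q c !s) z w)
    (hown : ∀ q z w k, P q z w → z k = none → R q (put z k !s) w)
    (hopp : ∀ q z w k, P q z w → w k = none → R q z (put w k !s))
    {q : E ⊕ Bool × Bool → Option Bool} {c : E ⊕ Bool × Bool} (hq : PairView s P q)
    (hc : q c = none) : PairView s R (put q c !s) := by
  obtain c | ⟨t, k⟩ := c
  · exact pairView_put_inl.2 (hE _ _ _ c hq hc)
  · obtain rfl | rfl : t = s ∨ t = !s := by cases t <;> cases s <;> simp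
    · exact pairView_put_own.2 (hown _ _ _ k hq hc)
    · exact pairView_put_opp.2 (hopp _ _ _ k hq hc)

/-- The opponent's additional cells are untouched, or both are colored, but not both with the
color of the opponent. -/
def SafePair (s : Bool) (w : Bool → Option Bool) : Prop :=
  (∀ k, w k = none) ∨ ((∀ k, w k ≠ none) ∧ ∃ k, w k = some s)

theorem SafePair.reply {w : Bool → Option Bool} (h : SafePair s w) {k : Bool} (hk : w k = none) :
    ∃ k', put w k (!s) k' = none ∧ SafePair s (put (put w k !s) k' s) := by
  obtain h | ⟨h, -⟩ := h
  · have hne : (!k) ≠ k := by simp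
    refine ⟨!k, by rw [put_of_ne _ _ hne, h], .inr ⟨fun l => ?_, !k, put_self _ _ _⟩⟩
    obtain rfl | rfl : l = k ∨ l = !k := by cases l <;> cases k <;> simp
    · rw [put_of_ne _ _ hne.symm, put_self]
      simp
    · simp
  · exact (h k hk).elim

/-- The additional cells of a player encode the bit `b`. -/
def PairCode (b : Bool) (z : Bool → Option Bool) : Prop := z false = some b ∧ z true = some !b

theorem SafePair.cases {w : Bool → Option Bool} (h : SafePair s w) :
    (∀ k, w k = none) ∨ (∀ k, w k = some s) ∨ ∃ b, PairCode b w := by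
  obtain h | ⟨h, k, hk⟩ := h
  · exact .inl h
  · obtain ⟨x, hx⟩ := Option.ne_none_iff_exists'.1 (h (!k))
    refine .inr ?_
    by_cases hxs : x = s
    · subst hxs
      refine .inl fun l => ?_
      obtain rfl | rfl : l = k ∨ l = !k := by cases l <;> cases k <;> simp
      · exact hk
      · exact hx
    · obtain rfl : x = !s := by cases x <;> cases s <;> simp_all
      cases k
      · exact .inr ⟨s, hk, hx⟩
      · exact .inr ⟨!s, hx, by simpa using hk⟩

/-- In the code `(b, !b)`, the entry equal to `s` has index `b ^^ s`. Coloring that cell threatens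
to complete the pair, and the opponent's forced answer in the other cell completes the code of `b`.
-/
theorem pairCode_put {b k : Bool} {w : Bool → Option Bool} (h : w k = some s)
    (hb : k = (b ^^ s)) : PairCode b (put w (!k) !s) := by
  subst hb
  cases b <;> cases s <;> simp_all [PairCode, put]

namespace SwitchStrategy

variable {φ : (E → Bool) → Outcome ι} {avail good : Set ι} (σ : SwitchStrategy φ s avail good)
  (mk : ι → Bool → κ)

/-- The player `s` wins the extended switch. -/
def PairWins (q : E → Option Bool) (z w : Bool → Option Bool) : Prop :=
  (σ.holds (.ext s) q ∧ SafePair s w) ∨ ((∀ k, z k = some s) ∧ SafePair s w) ∨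
    ((∃ j, σ.holds (.sym (!s) j) q) ∧ ∀ k, w k = some s)

/-- The player `s` has chosen, or is about to choose, the bit `b`, and secures the symbol `i`. -/
def PairHoldsMine (i : ι) (b : Bool) (q : E → Option Bool) (z w : Bool → Option Bool) : Prop :=
  SafePair s w ∧ ((σ.holds (.sym s i) q ∧ PairCode b z) ∨
    (CanReach s (σ.holds (.sym s i)) q ∧ z (b ^^ s) = some s ∧ z (!(b ^^ s)) = none))

/-- The opponent has chosen the bit `b`, and `s` secures the symbol `j` of the opponent. -/
def PairHoldsTheirs (j : ι) (b : Bool) (q : E → Option Bool) (w : Bool → Option Bool) : Prop :=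
  σ.holds (.sym (!s) j) q ∧ PairCode b w

/-- The player `s` secures an outcome of the extended switch. -/
def PairHolds (t : Outcome κ) (q : E → Option Bool) (z w : Bool → Option Bool) : Prop :=
  σ.PairWins q z w ∨ (∃ i b, t = .sym s (mk i b) ∧ σ.PairHoldsMine i b q z w) ∨
    ∃ j b, t = .sym (!s) (mk j b) ∧ σ.PairHoldsTheirs j b q w

/-- The player `s` threatens to win the extended switch. -/
def PairWinning (q : E → Option Bool) (_ w : Bool → Option Bool) : Prop :=
  (σ.winning q ∧ SafePair s w) ∨
    ((∃ j, σ.holds (.sym (!s) j) q) ∧ ∃ k, w k = some s ∧ w (!k) = none)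

/-- The player `s` still has all options in the extended switch. -/
def PairCalm (q : E → Option Bool) (z w : Bool → Option Bool) : Prop :=
  σ.calm q ∧ (∀ k, z k = none) ∧ SafePair s w

variable {σ mk} {t : Outcome κ} {q : E → Option Bool} {z w : Bool → Option Bool}

/-- A reply in the unmodified switch. -/
theorem pairCanReach_of_canReach {Q : (E → Option Bool) → Prop} (h : CanReach s Q q)
    (hP : ∀ q, Q q → P q z w) : P q z w ∨ PairCanMoveTo s P q z w := by
  obtain h | ⟨c, hc, h⟩ := h
  · exact .inl (hP _ h)
  · exact .inr (.inl ⟨c, hc, hP _ h⟩)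

theorem pairCanMoveTo_of_canMoveTo {Q : (E → Option Bool) → Prop} (h : CanMoveTo s Q q)
    (hP : ∀ q, Q q → P q z w) : PairCanMoveTo s P q z w := by
  obtain ⟨c, hc, h⟩ := h
  exact .inl ⟨c, hc, hP _ h⟩

/-- A reply in the opponent's additional cells. -/
theorem pairCanMoveTo_reply (hw : SafePair s w) {k : Bool} (hk : w k = none)
    (hP : ∀ w, SafePair s w → P q z w) : PairCanMoveTo s P q z (put w k !s) := by
  obtain ⟨k', hk', h⟩ := hw.reply hk
  exact .inr (.inr ⟨k', hk', hP _ h⟩)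

theorem forall_put_eq {w : Bool → Option Bool} {k x : Bool} (h : w k = some x) (l : Bool) :
    put w (!k) x l = some x := by
  obtain rfl | rfl : l = k ∨ l = !k := by cases l <;> cases k <;> simp
  · rw [put_of_ne _ _ (by simp), h]
  · exact put_self _ _ _

/-- Completing the opponent's pair of cells with a second cell of the same color. -/
theorem pairWins_put_of_theirs {j : ι} (h : σ.holds (.sym (!s) j) q) {k : Bool}
    (hk : w k = some s) : σ.PairWins q z (put w (!k) s) :=
  .inr (.inr ⟨⟨j, h⟩, forall_put_eq hk⟩)

theorem pairWins_put_own (hw : SafePair s w) {k : Bool} (hk : z k = some s) :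
    σ.PairWins q (put z (!k) s) w :=
  .inr (.inl ⟨forall_put_eq hk, hw⟩)

theorem pairWins_of_canReach (h : CanReach s (σ.holds (.ext s)) q) (hw : SafePair s w) :
    PairHolds σ mk t q z w ∨ PairCanMoveTo s (PairHolds σ mk t) q z w :=
  pairCanReach_of_canReach h fun _ h => .inl (.inl ⟨h, hw⟩)

theorem pairHolds_move_core {c : E} (h : PairHolds σ mk t q z w) (hc : q c = none) :
    PairHolds σ mk t (put q c !s) z w ∨
      PairCanMoveTo s (PairHolds σ mk t) (put q c !s) z w := by
  obtain (⟨h, hw⟩ | ⟨h, hw⟩ | ⟨⟨j, h⟩, hw⟩) | ⟨i, b, rfl, hw, ⟨h, hb⟩ | ⟨-, h, h'⟩⟩ |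
    ⟨j, b, rfl, h, hb⟩ := h
  · exact pairWins_of_canReach (σ.holds_move _ q c h hc) hw
  · exact .inl (.inl (.inr (.inl ⟨h, hw⟩)))
  · exact pairCanReach_of_canReach (σ.holds_move _ q c h hc)
      fun _ h => .inl (.inr (.inr ⟨⟨j, h⟩, hw⟩))
  · exact pairCanReach_of_canReach (σ.holds_move _ q c h hc)
      fun _ h => .inr (.inl ⟨i, b, rfl, hw, .inl ⟨h, hb⟩⟩)
  -- The opponent ignores the threat, so `s` completes the pair and wins.
  · exact .inr (.inr (.inl ⟨_, h', .inl (pairWins_put_own hw h)⟩))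
  · exact pairCanReach_of_canReach (σ.holds_move _ q c h hc)
      fun _ h => .inr (.inr ⟨j, b, rfl, h, hb⟩)

theorem pairHolds_move_own {k : Bool} (h : PairHolds σ mk t q z w) (hk : z k = none) :
    PairHolds σ mk t q (put z k !s) w ∨
      PairCanMoveTo s (PairHolds σ mk t) q (put z k !s) w := by
  obtain (⟨h, hw⟩ | ⟨h, hw⟩ | ⟨⟨j, h⟩, hw⟩) | ⟨i, b, rfl, hw, ⟨h, hb⟩ | ⟨h, hz, h'⟩⟩ |
    ⟨j, b, rfl, h, hb⟩ := h
  · exact .inl (.inl (.inl ⟨h, hw⟩))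
  · simp [h] at hk
  · exact .inl (.inl (.inr (.inr ⟨⟨j, h⟩, hw⟩)))
  · cases k <;> simp [hb.1, hb.2] at hk
  · obtain rfl : k = !(b ^^ s) := by
      by_contra hne
      obtain rfl : k = (b ^^ s) := by revert hne; cases k <;> cases b <;> cases s <;> simp
      simp [hz] at hk
    -- The forced answer has completed the code, and `s` has the turn again for the pending move in
    -- the old switch.
    exact pairCanReach_of_canReach h fun _ h =>
      .inr (.inl ⟨i, b, rfl, hw, .inl ⟨h, pairCode_put hz rfl⟩⟩)
  · exact .inl (.inr (.inr ⟨j, b, rfl, h, hb⟩))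

theorem pairHolds_move_opp {k : Bool} (h : PairHolds σ mk t q z w) (hk : w k = none) :
    PairHolds σ mk t q z (put w k !s) ∨
      PairCanMoveTo s (PairHolds σ mk t) q z (put w k !s) := by
  obtain (⟨h, hw⟩ | ⟨h, hw⟩ | ⟨⟨j, h⟩, hw⟩) | ⟨i, b, rfl, hw, h⟩ | ⟨j, b, rfl, h, hb⟩ := h
  · exact .inr (pairCanMoveTo_reply hw hk fun w hw => .inl (.inl ⟨h, hw⟩))
  · exact .inr (pairCanMoveTo_reply hw hk fun w hw => .inl (.inr (.inl ⟨h, hw⟩)))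
  · simp [hw] at hk
  · exact .inr (pairCanMoveTo_reply hw hk fun w hw => .inr (.inl ⟨i, b, rfl, hw, h⟩))
  · cases k <;> simp [hb.1, hb.2] at hk

/-- If `s` holds a symbol of the opponent in the unmodified switch, then either that symbol is
completely chosen, or `s` can start to choose it. -/
theorem pairReply_of_theirs {j : ι} (h : σ.holds (.sym (!s) j) q) (hw : SafePair s w) :
    (∀ t, σ.PairHolds mk t q z w) ∨ (∃ j, σ.PairHolds mk (.sym (!s) j) q z w) ∨
      PairCanMoveTo s σ.PairWinning q z w := by
  obtain hw | hw | ⟨b, hb⟩ := hw.cases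
  -- Coloring one cell of the opponent's untouched pair threatens to take both, which would turn
  -- every symbol of the opponent into a win for `s`. The index `true` is arbitrary.
  · refine .inr (.inr (.inr (.inr ⟨true, hw _, .inr ⟨⟨j, h⟩, true, put_self _ _ _, ?_⟩⟩)))
    rw [put_of_ne _ _ (by simp), hw]
  · exact .inl fun t => .inl (.inr (.inr ⟨⟨j, h⟩, hw⟩))
  · exact .inr (.inl ⟨mk j b, .inr (.inr ⟨j, b, rfl, h, hb⟩)⟩)

variable (σ mk) in
/-- The strategy for an extended switch. -/
def extend {avail' good' : Set κ} (h_avail : ∀ x ∈ avail', ∃ i ∈ avail, ∃ b, x = mk i b)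
    (h_good : ∀ i ∈ good, ∃ b, mk i b ∈ good') :
    SwitchStrategy (extendSwitch φ mk) s avail' good' where
  holds t := PairView s (σ.PairHolds mk t)
  winning := PairView s σ.PairWinning
  calm := PairView s σ.PairCalm
  holds_full := by
    intro t w h
    have hsafe : SafePair s (fun k => some (w (.inr (!s, k)))) →
        ∃ k, w (.inr (!s, k)) = s := by
      rintro (h | ⟨-, k, hk⟩)
      · simpa using h true
      · exact ⟨k, by simpa using hk⟩
    simp only [PairView, PairHolds, PairWins, PairHoldsMine, PairHoldsTheirs, PairCode,
      Option.some.injEq, reduceCtorEq, and_false, or_false] at h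
    unfold extendSwitch
    obtain (⟨h, hw⟩ | ⟨h, hw⟩ | ⟨⟨j, h⟩, hw⟩) | ⟨i, b, rfl, hw, h, hb⟩ | ⟨j, b, rfl, h, hb⟩ := h
    · rw [Outcome.eq_of_ext_sideLe (σ.holds_full _ _ h), pairOutcome_ext mk (hsafe hw)]
      exact Outcome.sideLe_ext
    · rw [pairOutcome_of_own mk h (hsafe hw)]
      exact Outcome.sideLe_ext
    · obtain h | h := Outcome.eq_of_sym_sideLe (σ.holds_full _ _ h)
      · rw [h, pairOutcome_theirs_of_all mk hw]
        exact Outcome.sideLe_ext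
      · rw [h, pairOutcome_ext mk ⟨true, hw true⟩]
        exact Outcome.sideLe_ext
    · obtain h | h := Outcome.eq_of_sym_sideLe (σ.holds_full _ _ h)
      · rw [h]
        exact sideLe_pairOutcome_mine mk (hsafe hw) hb.1 hb.2 i
      · rw [h, pairOutcome_ext mk (hsafe hw)]
        exact Outcome.sideLe_ext
    · obtain h | h := Outcome.eq_of_sym_sideLe (σ.holds_full _ _ h)
      · rw [h]
        exact sideLe_pairOutcome_theirs mk hb.1 hb.2 j
      · rw [h, pairOutcome_ext mk]
        · exact Outcome.sideLe_ext
        · by_cases hbs : b = s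
          · exact ⟨false, hb.1.trans hbs⟩
          · refine ⟨true, hb.2.trans ?_⟩
            cases b <;> cases s <;> simp_all
  holds_move := by
    intro t q c hq hc
    refine Or.imp_right canMoveTo_pairView (pairView_move
      (R := fun q z w => σ.PairHolds mk t q z w ∨ PairCanMoveTo s (σ.PairHolds mk t) q z w)
      (fun q z w c => pairHolds_move_core) (fun q z w k => pairHolds_move_own)
      (fun q z w k => pairHolds_move_opp) hq hc)
  winning_threat := by
    intro q hq
    refine Or.imp_right canMoveTo_pairView (?_ : PairView s (fun q z w =>
      σ.PairHolds mk (.ext s) q z w ∨ PairCanMoveTo s (σ.PairHolds mk (.ext s)) q z w) q)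
    obtain ⟨h, hw⟩ | ⟨⟨j, h⟩, k, hk, hk'⟩ := hq
    · exact pairWins_of_canReach (σ.winning_threat _ h) hw
    · exact .inr (.inr (.inr ⟨!k, hk', .inl (pairWins_put_of_theirs h hk)⟩))
  winning_move := by
    intro q c hq hc
    have : PairView s (fun q z w => (σ.PairHolds mk (.ext s) q z w ∨
        PairCanMoveTo s (σ.PairHolds mk (.ext s)) q z w) ∨
        (∃ j, σ.PairHolds mk (.sym (!s) j) q z w) ∨ PairCanMoveTo s σ.PairWinning q z w)
        (put q c !s) := by
      refine pairView_move ?_ ?_ ?_ hq hc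
      · rintro q z w c (⟨h, hw⟩ | ⟨⟨j, h⟩, hw⟩) hc
        · obtain h | ⟨j, h⟩ | h := σ.winning_move _ c h hc
          · exact .inl (pairWins_of_canReach h hw)
          · obtain h | h := pairReply_of_theirs (mk := mk) h hw
            · exact .inl (.inl (h _))
            · exact .inr h
          · exact .inr (.inr (pairCanMoveTo_of_canMoveTo h fun _ h => .inl ⟨h, hw⟩))
        · obtain h | h := σ.holds_move _ _ c h hc
          · obtain ⟨k, hk, hk'⟩ := hw
            exact .inl (.inr (.inr (.inr ⟨!k, hk', .inl (pairWins_put_of_theirs h hk)⟩)))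
          · exact .inr (.inr (pairCanMoveTo_of_canMoveTo h fun _ h => .inr ⟨⟨j, h⟩, hw⟩))
      · rintro q z w k (⟨h, hw⟩ | ⟨⟨j, h⟩, k, hk, hk'⟩) -
        · exact .inl (pairWins_of_canReach (σ.winning_threat _ h) hw)
        · exact .inl (.inr (.inr (.inr ⟨!k, hk', .inl (pairWins_put_of_theirs h hk)⟩)))
      · rintro q z w k (⟨h, hw⟩ | ⟨⟨j, h⟩, l, hl, hl'⟩) hk
        · exact .inr (.inr (pairCanMoveTo_reply hw hk fun _ hw => .inl ⟨h, hw⟩))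
        · obtain rfl : k = !l := by
            by_contra hne
            obtain rfl : k = l := by revert hne; cases k <;> cases l <;> simp
            simp [hl] at hk
          refine .inr (.inl ⟨mk j (l ^^ s), .inr (.inr ⟨j, _, rfl, h, pairCode_put hl ?_⟩)⟩)
          cases l <;> cases s <;> rfl
    exact this.imp (Or.imp_right canMoveTo_pairView) (Or.imp_right canMoveTo_pairView)
  calm_choose := by
    rintro q ⟨h, hz, hw⟩ x hx
    obtain ⟨i, hi, b, rfl⟩ := h_avail x hx
    -- The bit comes first: it is chosen with a threat, so the turn for choosing `i` in the old
    -- switch is not lost.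
    refine .inr (canMoveTo_pairView (.inr (.inl ⟨b ^^ s, hz _, .inr (.inl ⟨i, b, rfl, hw,
      .inr ⟨σ.calm_choose _ h i hi, put_self _ _ _, ?_⟩⟩)⟩)))
    rw [put_of_ne _ _ (by simp)]
    exact hz _
  calm_win := by
    rintro q ⟨h, hz, hw⟩
    exact canMoveTo_pairView (pairCanMoveTo_of_canMoveTo (σ.calm_win _ h) fun _ h => .inl ⟨h, hw⟩)
  calm_move := by
    intro q c hq hc
    have : PairView s (fun q z w => (∃ i ∈ good', σ.PairHolds mk (.sym s i) q z w ∨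
        PairCanMoveTo s (σ.PairHolds mk (.sym s i)) q z w) ∨
        (∃ j, σ.PairHolds mk (.sym (!s) j) q z w) ∨ PairCanMoveTo s σ.PairCalm q z w ∨
        PairCanMoveTo s σ.PairWinning q z w) (put q c !s) := by
      refine pairView_move ?_ ?_ ?_ hq hc
      · rintro q z w c ⟨h, hz, hw⟩ hc
        obtain ⟨i, hi, h⟩ | ⟨j, h⟩ | h | h := σ.calm_move _ c h hc
        · obtain ⟨b, hb⟩ := h_good i hi
          refine .inl ⟨_, hb, .inr (.inr (.inl ⟨b ^^ s, hz _, .inr (.inl ⟨i, b, rfl, hw,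
            .inr ⟨h, put_self _ _ _, ?_⟩⟩)⟩))⟩
          rw [put_of_ne _ _ (by simp)]
          exact hz _
        · obtain h' | h | h := pairReply_of_theirs (mk := mk) h hw
          · exact .inr (.inl ⟨mk j true, h' _⟩)
          · exact .inr (.inl h)
          · exact .inr (.inr (.inr h))
        · exact .inr (.inr (.inl (pairCanMoveTo_of_canMoveTo h fun _ h => ⟨h, hz, hw⟩)))
        · exact .inr (.inr (.inr (pairCanMoveTo_of_canMoveTo h fun _ h => .inl ⟨h, hw⟩)))
      -- The opponent has spoiled a cell that `s` needs for encoding a bit. Now `s` plays for a win,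
      -- and `PairWinning` does not depend on the pair of `s`.
      · rintro q z w k ⟨h, -, hw⟩ -
        exact .inr (.inr (.inr (pairCanMoveTo_of_canMoveTo (σ.calm_win _ h)
          fun _ h => .inl ⟨h, hw⟩)))
      · rintro q z w k ⟨h, hz, hw⟩ hk
        exact .inr (.inr (.inl (pairCanMoveTo_reply hw hk fun _ hw => ⟨h, hz, hw⟩)))
    exact this.imp (fun ⟨i, hi, h⟩ => ⟨i, hi, h.imp_right canMoveTo_pairView⟩)
      (Or.imp_right (Or.imp canMoveTo_pairView canMoveTo_pairView))
  calm_start := ⟨σ.calm_start, fun _ => rfl, .inl fun _ => rfl⟩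

end SwitchStrategy

end Extend

/-! ### Switches with many symbols -/

/-- There is a switch with `n` cells in which each player `s` can choose among the symbols in
`avail s` or, if the opponent moves first, secure one of the symbols in `good s`. -/
def HasSwitch (n : ℕ) (ι : Type) (avail good : Bool → Set ι) : Prop :=
  ∃ (E : Type) (_ : Finite E) (_ : DecidableEq E) (φ : (E → Bool) → Outcome ι),
    (∀ v w, v ≤ w → Outcome.SideLe true (φ v) (φ w)) ∧ Nat.card E = n ∧
    ∀ s, Nonempty (SwitchStrategy φ s (avail s) (good s))

/-- The symbols of a switch that has been extended `k` times. -/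
def Codes (ι : Type) : ℕ → Type
  | 0 => ι
  | k + 1 => Codes ι k × Bool

namespace Codes

variable {ι : Type}

/-- The symbol of the original switch. -/
def root : {k : ℕ} → Codes ι k → ι
  | 0, x => x
  | _ + 1, x => root x.1

/-- The number that is encoded by the additional bits. -/
def index : {k : ℕ} → Codes ι k → ℕ
  | 0, _ => 0
  | _ + 1, x => 2 * index x.1 + x.2.toNat

/-- The symbol with the given root and the given number. -/
def make (i : ι) : (k : ℕ) → ℕ → Codes ι k
  | 0, _ => i
  | k + 1, m => (make i k (m / 2), m.testBit 0)

theorem root_make (i : ι) (k m : ℕ) : (make i k m).root = i := by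
  induction k generalizing m with
  | zero => rfl
  | succ k ih => exact ih _

theorem index_make (i : ι) (k m : ℕ) (hm : m < 2 ^ k) : (make i k m).index = m := by
  induction k generalizing m with
  | zero => exact (Nat.lt_one_iff.1 hm).symm
  | succ k ih =>
    simp only [make, index]
    rw [ih _ (by omega), Nat.testBit_zero]
    obtain h | h := Nat.mod_two_eq_zero_or_one m <;> simp [h] <;> omega

end Codes

/-- All choices of bits are available, but among the good symbols only those with number `0` are
kept: this number will be given to a good option. -/
theorem HasSwitch.extend {n : ℕ} {ι : Type} {avail good : Bool → Set ι}
    (h : HasSwitch n ι avail good) (k : ℕ) :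
    HasSwitch (n + 4 * k) (Codes ι k) (fun s => {x | x.root ∈ avail s})
      (fun s => {x | x.root ∈ good s ∧ x.index = 0}) := by
  induction k with
  | zero => simpa [Codes, Codes.root, Codes.index] using h
  | succ k ih =>
    obtain ⟨E, _, _, φ, hφ, hE, hσ⟩ := ih
    refine ⟨E ⊕ Bool × Bool, inferInstance, inferInstance, extendSwitch φ Prod.mk,
      fun v w hvw => pairOutcome_mono _ (hφ _ _ fun c => hvw _) fun t k => hvw _, ?_, fun s => ?_⟩
    · rw [Nat.card_sum, hE]
      simp
      omega
    · obtain ⟨σ⟩ := hσ s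
      refine ⟨σ.extend Prod.mk (fun x hx => ⟨x.1, hx, x.2, rfl⟩) fun i hi => ⟨false, hi.1, ?_⟩⟩
      simp [Codes.index, hi.2]

/-! ### Switches that are given by tables

The cells are numbered, and sets of cells are encoded as the natural numbers with the
corresponding bits. The outcomes are encoded as natural numbers as well, where `0` is a win for
the right, and `1` a win for the left player. -/

section Table

variable {ι : Type}

/-- The order on codes of outcomes from the side of the player `s`. -/
def codeLe (s : Bool) (x y : ℕ) : Bool :=
  Nat.beq x y || Nat.beq x (!s).toNat || Nat.beq y s.toNat

/-- The set of cells of the left player, given the set of cells of the player `s`. -/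
def leftMask (n : ℕ) (s : Bool) (a : ℕ) : ℕ := bif s then a else (2 ^ n - 1) ^^^ a

/-- All cells outside `m` satisfy `P`. -/
def freeAll (n m : ℕ) (P : ℕ → Bool) : Bool := (List.range n).all fun c => m.testBit c || P c

/-- Some cell outside `m` satisfies `P`. -/
def freeAny (n m : ℕ) (P : ℕ → Bool) : Bool := (List.range n).any fun c => !m.testBit c && P c

/-- The position in which `s` has the cells in `a` and the opponent has the cells in `b`. -/
def maskPosition (n : ℕ) (s : Bool) (a b : ℕ) (c : Fin n) : Option Bool :=
  if a.testBit c then some s else if b.testBit c then some !s else none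

section Check

variable (n : ℕ) (code : ℕ → ℕ) (s : Bool)

/-- The outcome is at least `x` even if the opponent gets all cells outside `a`. -/
def guaranteed (x a : ℕ) : Bool := codeLe s x (code (leftMask n s a))

/-- The outcome is at least `x` if the player `s` gets all cells outside `b`. -/
def possible (x b : ℕ) : Bool := codeLe s x (code (leftMask n (!s) b))

/-- A sufficient condition for `s` to secure the outcome `x` if the opponent is to move. -/
def holdsCheck (x : ℕ) : ℕ → ℕ → ℕ → Bool
  | 0, a, _ => guaranteed n code s x a
  | k + 1, a, b => guaranteed n code s x a ||
      -- The `possible` tests only prune the search. The test for an empty cell ensures that a full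
      -- position passes only through `guaranteed`.
      (possible n code s x b && !Nat.beq (a ||| b) (2 ^ n - 1) &&
        freeAll n (a ||| b) fun c => guaranteed n code s x a ||
          (possible n code s x (b ||| 2 ^ c) && freeAny n (a ||| (b ||| 2 ^ c)) fun d =>
            holdsCheck x k (a ||| 2 ^ d) (b ||| 2 ^ c)))

/-- A sufficient condition for `s` to secure the outcome `x` if `s` is to move. -/
def reachCheck (x a b : ℕ) : Bool :=
  guaranteed n code s x a || (possible n code s x b && freeAny n (a ||| b) fun d =>
    holdsCheck n code s x n (a ||| 2 ^ d) b)

/-- The player `s` can move to a position in the list. -/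
def moveCheck (l : List (ℕ × ℕ)) (a b : ℕ) : Bool :=
  freeAny n (a ||| b) fun d => l.any fun p => Nat.beq p.1 (a ||| 2 ^ d) && Nat.beq p.2 b

/-- The condition on the table for the order of outcomes. -/
def monotoneCheck : Bool :=
  (List.range (2 ^ n)).all fun m => freeAll n m fun c => codeLe true (code m) (code (m ||| 2 ^ c))

/-- The conditions on the list of winning positions. -/
def winningCheck (theirs : List ℕ) (win : List (ℕ × ℕ)) : Bool :=
  win.all fun p => Nat.blt p.1 (2 ^ n) && Nat.blt p.2 (2 ^ n) &&
    reachCheck n code s s.toNat p.1 p.2 && freeAll n (p.1 ||| p.2) fun c =>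
      moveCheck n win p.1 (p.2 ||| 2 ^ c) ||
      (theirs.any fun y => holdsCheck n code s y n p.1 (p.2 ||| 2 ^ c)) ||
      reachCheck n code s s.toNat p.1 (p.2 ||| 2 ^ c)

/-- The conditions on the list of calm positions. -/
def calmCheck (mine good theirs : List ℕ) (win calm : List (ℕ × ℕ)) : Bool :=
  calm.all fun p => Nat.blt p.1 (2 ^ n) && Nat.blt p.2 (2 ^ n) &&
    (mine.all fun x => reachCheck n code s x p.1 p.2) && moveCheck n win p.1 p.2 &&
    freeAll n (p.1 ||| p.2) fun c =>
      moveCheck n calm p.1 (p.2 ||| 2 ^ c) || moveCheck n win p.1 (p.2 ||| 2 ^ c) ||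
      (theirs.any fun y => holdsCheck n code s y n p.1 (p.2 ||| 2 ^ c)) ||
      good.any fun x => reachCheck n code s x p.1 (p.2 ||| 2 ^ c)

end Check

-- Soundness of the checks on tables.

variable {n : ℕ} {code : ℕ → ℕ} {s : Bool}

theorem freeAll_iff {m : ℕ} {P : ℕ → Bool} :
    freeAll n m P ↔ ∀ c : Fin n, m.testBit c = false → P c := by
  simp [freeAll, Fin.forall_iff, or_iff_not_imp_left]

theorem freeAny_iff {m : ℕ} {P : ℕ → Bool} :
    freeAny n m P ↔ ∃ c : Fin n, m.testBit c = false ∧ P c := by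
  simp [freeAny, Fin.exists_iff, and_left_comm]

theorem maskPosition_eq_none {a b : ℕ} {c : Fin n} :
    maskPosition n s a b c = none ↔ (a ||| b).testBit c = false := by
  rw [Nat.testBit_or]
  unfold maskPosition
  cases a.testBit c <;> cases b.testBit c <;> simp

theorem testBit_or_two_pow (a : ℕ) (c d : ℕ) :
    (a ||| 2 ^ c).testBit d = (a.testBit d || decide (c = d)) := by
  rw [Nat.testBit_or, Nat.testBit_two_pow]

/-- The bits of `a` take precedence over those of `b`, so the cell may be arbitrary here; for a move
of the opponent it must not belong to `a`. -/
theorem put_maskPosition_own {a b : ℕ} {c : Fin n} :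
    put (maskPosition n s a b) c s = maskPosition n s (a ||| 2 ^ c.1) b := by
  funext d
  unfold maskPosition
  rw [testBit_or_two_pow]
  by_cases h : d = c
  · subst h
    simp
  · rw [put_of_ne _ _ h]
    simp [Fin.val_ne_of_ne (Ne.symm h)]

theorem put_maskPosition_opp {a b : ℕ} {c : Fin n} (hc : maskPosition n s a b c = none) :
    put (maskPosition n s a b) c (!s) = maskPosition n s a (b ||| 2 ^ c.1) := by
  rw [maskPosition_eq_none, Nat.testBit_or, Bool.or_eq_false_iff] at hc
  funext d
  unfold maskPosition
  rw [testBit_or_two_pow]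
  by_cases h : d = c
  · subst h
    simp [hc.1]
  · rw [put_of_ne _ _ h]
    simp [Fin.val_ne_of_ne (Ne.symm h)]

theorem canMoveTo_maskPosition {P : (Fin n → Option Bool) → Prop} {a b : ℕ} {Q : ℕ → Bool}
    (h : freeAny n (a ||| b) Q)
    (hQ : ∀ d : Fin n, Q d → P (maskPosition n s (a ||| 2 ^ d.1) b)) :
    CanMoveTo s P (maskPosition n s a b) := by
  obtain ⟨d, hd, h⟩ := freeAny_iff.1 h
  refine ⟨d, maskPosition_eq_none.2 hd, ?_⟩
  rw [put_maskPosition_own]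
  exact hQ d h

variable (n code s) in
/-- The positions in which `s` secures the outcome with the code `x`. -/
def TableHolds (x : ℕ) (q : Fin n → Option Bool) : Prop :=
  ∃ k a b, a < 2 ^ n ∧ b < 2 ^ n ∧ q = maskPosition n s a b ∧ holdsCheck n code s x k a b

theorem or_two_pow_lt {a : ℕ} (h : a < 2 ^ n) (c : Fin n) : a ||| 2 ^ c.1 < 2 ^ n :=
  Nat.or_lt_two_pow h (Nat.pow_lt_pow_right Nat.one_lt_two c.2)

theorem tableHolds_of_guaranteed {x a b : ℕ} (ha : a < 2 ^ n) (hb : b < 2 ^ n)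
    (h : guaranteed n code s x a) : TableHolds n code s x (maskPosition n s a b) :=
  ⟨0, a, b, ha, hb, rfl, h⟩

theorem canReach_of_reachCheck {x a b : ℕ} (ha : a < 2 ^ n) (hb : b < 2 ^ n)
    (h : reachCheck n code s x a b) :
    CanReach s (TableHolds n code s x) (maskPosition n s a b) := by
  simp only [reachCheck, Bool.or_eq_true, Bool.and_eq_true] at h
  obtain h | ⟨-, h⟩ := h
  · exact .inl (tableHolds_of_guaranteed ha hb h)
  · exact .inr (canMoveTo_maskPosition h fun d h => ⟨n, _, _, or_two_pow_lt ha d, hb, rfl, h⟩)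

theorem canMoveTo_of_moveCheck {l : List (ℕ × ℕ)} {a b : ℕ} (h : moveCheck n l a b) :
    CanMoveTo s (fun q => ∃ p ∈ l, q = maskPosition n s p.1 p.2) (maskPosition n s a b) := by
  refine canMoveTo_maskPosition h fun d h => ?_
  simp only [List.any_eq_true, Bool.and_eq_true, Nat.beq_eq] at h
  obtain ⟨p, hp, h₁, h₂⟩ := h
  exact ⟨p, hp, by rw [h₁, h₂]⟩

theorem tableHolds_move {x : ℕ} {q : Fin n → Option Bool} {c : Fin n}
    (hq : TableHolds n code s x q) (hc : q c = none) :
    CanReach s (TableHolds n code s x) (put q c !s) := by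
  obtain ⟨k, a, b, ha, hb, rfl, h⟩ := hq
  rw [put_maskPosition_opp hc]
  have hb' := or_two_pow_lt hb c
  obtain _ | k := k
  · exact .inl (tableHolds_of_guaranteed ha hb' h)
  simp only [holdsCheck, Bool.or_eq_true, Bool.and_eq_true] at h
  obtain h | ⟨-, h⟩ := h
  · exact .inl (tableHolds_of_guaranteed ha hb' h)
  have := freeAll_iff.1 h c (maskPosition_eq_none.1 hc)
  simp only [Bool.or_eq_true, Bool.and_eq_true] at this
  obtain h | ⟨-, h⟩ := this
  · exact .inl (tableHolds_of_guaranteed ha hb' h)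
  · exact .inr (canMoveTo_maskPosition h fun d h => ⟨k, _, _, or_two_pow_lt ha d, hb', rfl, h⟩)

theorem codeLe_of_tableHolds {x : ℕ} {w : Fin n → Bool}
    (h : TableHolds n code s x fun c => some (w c)) : codeLe s x (code (Nat.ofBits w)) := by
  obtain ⟨k, a, b, ha, hb, hq, h⟩ := h
  have hg : guaranteed n code s x a := by
    obtain _ | k := k
    · exact h
    simp only [holdsCheck, Bool.or_eq_true, Bool.and_eq_true] at h
    obtain h | ⟨⟨-, h⟩, -⟩ := h
    · exact h
    refine absurd (Nat.eq_of_testBit_eq fun c => ?_) (show a ||| b ≠ 2 ^ n - 1 by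
      intro h'
      simp [h'] at h)
    rw [Nat.testBit_two_pow_sub_one]
    by_cases hc : c < n
    · have h₁ : maskPosition n s a b ⟨c, hc⟩ ≠ none := by simp [← congrFun hq]
      rw [Ne, maskPosition_eq_none, Bool.not_eq_false] at h₁
      rw [h₁, decide_eq_true hc]
    · rw [decide_eq_false hc]
      exact Nat.testBit_lt_two_pow ((Nat.or_lt_two_pow ha hb).trans_le
        (Nat.pow_le_pow_right Nat.two_pos (not_lt.1 hc)))
  have hw : Nat.ofBits w = leftMask n s a := by
    have hbit (c : Fin n) : w c = (a.testBit c == s) := by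
      have := congrFun hq c
      revert this
      unfold maskPosition
      cases a.testBit c <;> cases b.testBit c <;> cases s <;> simp
    refine Nat.eq_of_testBit_eq fun c => ?_
    by_cases hc : c < n
    · rw [Nat.testBit_ofBits_lt _ _ hc, hbit]
      cases s <;> simp [leftMask, hc]
    · have hac : a.testBit c = false := Nat.testBit_lt_two_pow (ha.trans_le
        (Nat.pow_le_pow_right Nat.two_pos (not_lt.1 hc)))
      rw [Nat.testBit_ofBits_ge _ _ (not_lt.1 hc)]
      cases s <;> simp [leftMask, hc, hac]
  rw [hw]
  exact hg

/-- The check compares only masks that differ in one cell. Adding the cells of `m'` one at a time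
and using transitivity gives the general case. -/
theorem codeLe_of_monotoneCheck (h : monotoneCheck n code) (j m m' : ℕ) (hj : 2 ^ n - m = j)
    (hm' : m' < 2 ^ n) (hmm : ∀ c, m.testBit c → m'.testBit c) (dec : ℕ → Outcome ι)
    (hdec : ∀ x y, codeLe true x y → Outcome.SideLe true (dec x) (dec y)) :
    Outcome.SideLe true (dec (code m)) (dec (code m')) := by
  induction j using Nat.strong_induction_on generalizing m with | _ j ih
  by_cases hne : m = m'
  · rw [hne]
    exact .refl _ _
  obtain ⟨c, hc⟩ := Nat.exists_testBit_ne_of_ne hne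
  have h₁ : m'.testBit c = true ∧ m.testBit c = false := by
    have := hmm c
    revert hc this
    cases m'.testBit c <;> cases m.testBit c <;> simp
  have hcn : c < n := by
    by_contra hcn
    have := Nat.testBit_lt_two_pow (hm'.trans_le
        (Nat.pow_le_pow_right Nat.two_pos (not_lt.1 hcn)))
    simp [this] at h₁
  have hlt : m < m ||| 2 ^ c := by
    refine lt_of_le_of_ne Nat.left_le_or fun h => ?_
    have := congrArg (Nat.testBit · c) h
    simp [h₁.2] at this
  have hsub (d : ℕ) (hd : (m ||| 2 ^ c).testBit d) : m'.testBit d := by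
    rw [testBit_or_two_pow, Bool.or_eq_true, decide_eq_true_iff] at hd
    obtain hd | rfl := hd
    · exact hmm d hd
    · exact h₁.1
  have hle : m ||| 2 ^ c ≤ m' := Nat.le_of_testBit hsub
  have hm : m < 2 ^ n := by omega
  simp only [monotoneCheck, List.all_eq_true, List.mem_range] at h
  exact (hdec _ _ (freeAll_iff.1 (h m hm) ⟨c, hcn⟩ h₁.2)).trans
    (ih (2 ^ n - (m ||| 2 ^ c)) (by omega) _ rfl hsub)

variable (dec : ℕ → Outcome ι)

theorem dec_toNat (h₀ : dec 0 = .ext false) (h₁ : dec 1 = .ext true) : dec s.toNat = .ext s := by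
  cases s <;> assumption

theorem sideLe_of_codeLe (h₀ : dec 0 = .ext false) (h₁ : dec 1 = .ext true) {x y : ℕ}
    (h : codeLe s x y) : Outcome.SideLe s (dec x) (dec y) := by
  simp only [codeLe, Bool.or_eq_true, Nat.beq_eq] at h
  obtain (rfl | rfl) | rfl := h
  · exact .refl _ _
  · refine .inr (.inl ?_)
    cases s <;> simp [h₀, h₁]
  · refine .inr (.inr ?_)
    cases s <;> simp [h₀, h₁]

theorem CanReach.mono {E : Type} [DecidableEq E] {P Q : (E → Option Bool) → Prop}
    {q : E → Option Bool} (h : CanReach s P q) (hPQ : ∀ q, P q → Q q) : CanReach s Q q :=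
  h.imp (hPQ q) fun ⟨c, hc, h⟩ => ⟨c, hc, hPQ _ h⟩

theorem winningCheck_mem {theirs : List ℕ} {win : List (ℕ × ℕ)}
    (h : winningCheck n code s theirs win) {p : ℕ × ℕ} (hp : p ∈ win) :
    ((p.1 < 2 ^ n ∧ p.2 < 2 ^ n) ∧ reachCheck n code s s.toNat p.1 p.2) ∧
      freeAll n (p.1 ||| p.2) fun c => moveCheck n win p.1 (p.2 ||| 2 ^ c) ||
        (theirs.any fun y => holdsCheck n code s y n p.1 (p.2 ||| 2 ^ c)) ||
        reachCheck n code s s.toNat p.1 (p.2 ||| 2 ^ c) := by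
  have := List.all_eq_true.1 h p hp
  simpa only [Bool.and_eq_true, Nat.blt_eq] using this

theorem calmCheck_mem {mine good theirs : List ℕ} {win calm : List (ℕ × ℕ)}
    (h : calmCheck n code s mine good theirs win calm) {p : ℕ × ℕ} (hp : p ∈ calm) :
    (((p.1 < 2 ^ n ∧ p.2 < 2 ^ n) ∧ mine.all fun x => reachCheck n code s x p.1 p.2) ∧
      moveCheck n win p.1 p.2) ∧
      freeAll n (p.1 ||| p.2) fun c =>
        moveCheck n calm p.1 (p.2 ||| 2 ^ c) || moveCheck n win p.1 (p.2 ||| 2 ^ c) ||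
        (theirs.any fun y => holdsCheck n code s y n p.1 (p.2 ||| 2 ^ c)) ||
        good.any fun x => reachCheck n code s x p.1 (p.2 ||| 2 ^ c) := by
  have := List.all_eq_true.1 h p hp
  simpa only [Bool.and_eq_true, Nat.blt_eq] using this

theorem sideLe_of_monotoneCheck (h : monotoneCheck n code) (h₀ : dec 0 = .ext false)
    (h₁ : dec 1 = .ext true) {v w : Fin n → Bool} (hvw : v ≤ w) :
    Outcome.SideLe true (dec (code (Nat.ofBits v))) (dec (code (Nat.ofBits w))) := by
  refine codeLe_of_monotoneCheck h _ _ _ rfl (Nat.ofBits_lt_two_pow _) (fun c hc => ?_) dec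
    fun _ _ => sideLe_of_codeLe dec h₀ h₁
  by_cases hcn : c < n
  · rw [Nat.testBit_ofBits_lt _ _ hcn] at hc ⊢
    exact Bool.le_iff_imp.1 (hvw _) hc
  · rw [Nat.testBit_ofBits_ge _ _ (not_lt.1 hcn)] at hc
    simp at hc

/-- The strategy that is given by lists of winning and calm positions. -/
def tableStrategy {avail good : Set ι} {mine mineGood theirs : List ℕ}
    {win calm : List (ℕ × ℕ)} (h₀ : dec 0 = .ext false) (h₁ : dec 1 = .ext true)
    (h_mine : ∀ i ∈ avail, ∃ x ∈ mine, dec x = .sym s i)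
    (h_good : ∀ x ∈ mineGood, ∃ i ∈ good, dec x = .sym s i)
    (h_theirs : ∀ y ∈ theirs, ∃ j, dec y = .sym (!s) j)
    (h_win : winningCheck n code s theirs win)
    (h_calm : calmCheck n code s mine mineGood theirs win calm) (h_start : (0, 0) ∈ calm) :
    SwitchStrategy (fun w : Fin n → Bool => dec (code (Nat.ofBits w))) s avail good where
  holds t q := ∃ x, dec x = t ∧ TableHolds n code s x q
  winning q := ∃ p ∈ win, q = maskPosition n s p.1 p.2
  calm q := ∃ p ∈ calm, q = maskPosition n s p.1 p.2
  holds_full := by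
    rintro _ w ⟨x, rfl, h⟩
    exact sideLe_of_codeLe dec h₀ h₁ (codeLe_of_tableHolds h)
  holds_move := by
    rintro _ q c ⟨x, rfl, h⟩ hc
    exact (tableHolds_move h hc).imp (fun h => ⟨x, rfl, h⟩)
      fun ⟨c, hc, h⟩ => ⟨c, hc, x, rfl, h⟩
  winning_threat := by
    rintro _ ⟨p, hp, rfl⟩
    obtain ⟨⟨⟨ha, hb⟩, h⟩, -⟩ := winningCheck_mem h_win hp
    exact (canReach_of_reachCheck ha hb h).mono fun q hq => ⟨_, dec_toNat dec h₀ h₁, hq⟩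
  winning_move := by
    rintro _ c ⟨p, hp, rfl⟩ hc
    obtain ⟨⟨⟨ha, hb⟩, -⟩, h⟩ := winningCheck_mem h_win hp
    have hb' := or_two_pow_lt hb c
    rw [put_maskPosition_opp hc]
    have h := freeAll_iff.1 h c (maskPosition_eq_none.1 hc)
    simp only [Bool.or_eq_true, List.any_eq_true] at h
    obtain (h | ⟨y, hy, h⟩) | h := h
    · exact .inr (.inr (canMoveTo_of_moveCheck h))
    · obtain ⟨j, hj⟩ := h_theirs y hy
      exact .inr (.inl ⟨j, y, hj, _, _, _, ha, hb', rfl, h⟩)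
    · exact .inl ((canReach_of_reachCheck ha hb' h).mono fun q hq => ⟨_, dec_toNat dec h₀ h₁, hq⟩)
  calm_choose := by
    rintro _ ⟨p, hp, rfl⟩ i hi
    obtain ⟨⟨⟨⟨ha, hb⟩, h⟩, -⟩, -⟩ := calmCheck_mem h_calm hp
    obtain ⟨x, hx, hxi⟩ := h_mine i hi
    exact (canReach_of_reachCheck ha hb (List.all_eq_true.1 h x hx)).mono fun q hq => ⟨x, hxi, hq⟩
  calm_win := by
    rintro _ ⟨p, hp, rfl⟩
    exact canMoveTo_of_moveCheck (calmCheck_mem h_calm hp).1.2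
  calm_move := by
    rintro _ c ⟨p, hp, rfl⟩ hc
    obtain ⟨⟨⟨⟨ha, hb⟩, -⟩, -⟩, h⟩ := calmCheck_mem h_calm hp
    have hb' := or_two_pow_lt hb c
    rw [put_maskPosition_opp hc]
    have h := freeAll_iff.1 h c (maskPosition_eq_none.1 hc)
    simp only [Bool.or_eq_true, List.any_eq_true] at h
    obtain ((h | h) | ⟨y, hy, h⟩) | ⟨x, hx, h⟩ := h
    · exact .inr (.inr (.inl (canMoveTo_of_moveCheck h)))
    · exact .inr (.inr (.inr (canMoveTo_of_moveCheck h)))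
    · obtain ⟨j, hj⟩ := h_theirs y hy
      exact .inr (.inl ⟨j, y, hj, _, _, _, ha, hb', rfl, h⟩)
    · obtain ⟨i, hi, hxi⟩ := h_good x hx
      exact .inl ⟨i, hi, (canReach_of_reachCheck ha hb' h).mono fun q hq => ⟨x, hxi, hq⟩⟩
  calm_start := ⟨_, h_start, by funext c; simp [maskPosition]⟩

end Table

/-! ### A switch with seven cells and two symbols for each player -/

namespace TwoSymbolSwitch

/-- The codes of the outcomes, with three bits for each coloring. -/
def table : ℕ :=
  5628858028067412913506536137092743163592588569210211511725170235430574905040027497208859074695179806698201801555968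

/-- The code of the outcome. -/
def code (m : ℕ) : ℕ := (table >>> (3 * m)) % 8

/-- The outcome with the given code. -/
def decode : ℕ → Outcome Bool
  | 0 => .ext false
  | 1 => .ext true
  | 2 => .sym true false
  | 3 => .sym true true
  | 4 => .sym false false
  | _ => .sym false true

/-- The winning positions of the left player. -/
def leftWinning : List (ℕ × ℕ) :=
  [(16, 1), (20, 3), (84, 35), (52, 67), (24, 5), (20, 9), (20, 33), (22, 97), (20, 65), (16, 2),
    (24, 6), (20, 10), (20, 34), (21, 98), (20, 66), (11, 52), (11, 20), (10, 36), (26, 37),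
    (9, 68), (25, 70), (11, 84), (9, 4), (25, 6), (7, 88), (7, 24), (5, 40), (21, 42), (7, 56),
    (6, 72), (22, 73), (5, 8), (21, 10), (3, 80), (7, 112), (3, 16), (88, 35), (88, 33), (84, 34),
    (80, 32), (7, 80), (5, 96), (6, 64), (1, 0), (17, 2), (3, 4), (11, 68), (3, 8), (7, 72),
    (3, 32), (7, 96)]

/-- The calm positions of the left player. -/
def leftCalm : List (ℕ × ℕ) :=
  [(0, 0), (8, 4), (9, 20), (4, 8), (5, 24), (1, 16), (64, 32), (72, 33), (68, 34), (4, 64),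
    (6, 80)]

/-- The winning positions of the right player. -/
def rightWinning : List (ℕ × ℕ) :=
  [(18, 5), (18, 9), (14, 49), (14, 17), (10, 33), (26, 37), (6, 65), (22, 73), (14, 81), (6, 1),
    (22, 9), (17, 6), (17, 10), (13, 82), (13, 18), (5, 34), (21, 42), (13, 50), (9, 66),
    (25, 70), (5, 2), (21, 10), (16, 4), (17, 12), (81, 44), (49, 76), (17, 36), (25, 100),
    (17, 68), (16, 8), (17, 40), (21, 104), (17, 72), (12, 80), (13, 112), (12, 16), (82, 44),
    (82, 36), (81, 40), (80, 32), (13, 80), (5, 96), (9, 64), (4, 0), (12, 1), (14, 65), (12, 2),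
    (13, 66), (20, 8), (12, 32), (13, 96)]

/-- The calm positions of the right player. -/
def rightCalm : List (ℕ × ℕ) :=
  [(0, 0), (2, 1), (6, 17), (1, 2), (5, 18), (4, 16), (64, 32), (66, 36), (65, 40), (1, 64),
    (9, 80)]

/-- The table and the lists of positions are certificates; this and the following four facts are
finite computations. -/
theorem monotoneCheck_code : monotoneCheck 7 code = true := by decide +kernel

theorem winningCheck_left : winningCheck 7 code true [4, 5] leftWinning = true := by
  decide +kernel

theorem calmCheck_left :
    calmCheck 7 code true [2, 3] [2, 3] [4, 5] leftWinning leftCalm = true := by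
  decide +kernel

theorem winningCheck_right : winningCheck 7 code false [2, 3] rightWinning = true := by
  decide +kernel

theorem calmCheck_right :
    calmCheck 7 code false [4, 5] [4, 5] [2, 3] rightWinning rightCalm = true := by
  decide +kernel

/-- The two symbols of a player will stand for the two copies of the cells. -/
theorem hasSwitch : HasSwitch 7 Bool (fun _ => Set.univ) fun _ => Set.univ := by
  refine ⟨Fin 7, inferInstance, inferInstance, fun w => decode (code (Nat.ofBits w)),
    fun v w hvw => ?_, by simp, fun s => ?_⟩
  · exact sideLe_of_monotoneCheck decode monotoneCheck_code rfl rfl hvw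
  · cases s
    · refine ⟨tableStrategy decode rfl rfl ?_ ?_ ?_ winningCheck_right calmCheck_right
        (by decide)⟩ <;> simp [decode]
    · refine ⟨tableStrategy decode rfl rfl ?_ ?_ ?_ winningCheck_left calmCheck_left
        (by decide)⟩ <;> simp [decode]

end TwoSymbolSwitch

/-! ### A switch with eight cells that treats the players differently -/

namespace BiasedSwitch

/-- The codes of the outcomes, with three bits for each coloring, for the case that the left
player is favored. -/
def table : ℕ :=
  221788298945279984136595054692455218916812893526380861144937877779222606530173384800136659056430064415401867729593122871190635833434863736250146778742396832251305610126439621915857662978774493375856379541984737185963030624851722240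

/-- The code of the outcome if the player `g` is favored. The codes of symbols are relative to
`g`. -/
def code (g : Bool) (m : ℕ) : ℕ :=
  bif g then (table >>> (3 * m)) % 8
  -- Since `255 = 2 ^ 8 - 1`, `255 - m` exchanges the colors of all eight cells; `1 - x` exchanges
  -- the two wins.
  else (fun x => bif Nat.blt x 2 then 1 - x else x) ((table >>> (3 * (255 - m))) % 8)

/-- The outcome with the given code. -/
def decode (g : Bool) : ℕ → Outcome (Fin 3)
  | 0 => .ext false
  | 1 => .ext true
  | 2 => .sym g 0
  | 3 => .sym g 1
  | 4 => .sym (!g) 0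
  | 5 => .sym (!g) 1
  | _ => .sym (!g) 2

/-- The winning positions of the favored player. -/
def favoredWinning : List (ℕ × ℕ) :=
  [(2, 1), (34, 5), (50, 13), (42, 21), (6, 33), (14, 161), (6, 129), (41, 148), (41, 20), (9, 4),
    (25, 36), (89, 38), (2, 0), (34, 4), (50, 12)]

/-- The calm positions of the favored player. -/
def favoredCalm : List (ℕ × ℕ) :=
  [(0, 0), (1, 4), (9, 20)]

/-- The winning positions of the other player. -/
def otherWinning : List (ℕ × ℕ) :=
  [(8, 1), (24, 3), (10, 5), (10, 17), (138, 49), (42, 145), (24, 33), (24, 129), (20, 3),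
    (52, 11), (36, 10), (37, 26), (37, 138), (37, 146), (37, 18), (12, 130), (44, 146), (20, 2),
    (131, 76), (131, 12), (3, 68), (11, 196), (10, 132), (3, 4), (37, 10), (3, 8), (3, 80),
    (3, 16), (8, 32), (10, 48), (24, 96), (26, 100), (20, 65), (52, 73), (5, 64), (8, 128),
    (10, 144), (9, 192), (8, 0), (10, 16)]

/-- The calm positions of the other player. -/
def otherCalm : List (ℕ × ℕ) :=
  [(0, 0), (4, 2), (5, 18), (2, 4), (3, 12), (1, 8), (5, 10), (2, 16), (4, 64)]

theorem monotoneCheck_code (g : Bool) : monotoneCheck 8 (code g) = true := by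
  cases g <;> decide +kernel

theorem winningCheck_favored (g : Bool) :
    winningCheck 8 (code g) g [4, 5, 6] favoredWinning = true := by
  cases g <;> decide +kernel

theorem calmCheck_favored (g : Bool) :
    calmCheck 8 (code g) g [2, 3] [2, 3] [4, 5, 6] favoredWinning favoredCalm = true := by
  cases g <;> decide +kernel

theorem winningCheck_other (g : Bool) :
    winningCheck 8 (code g) (!g) [2, 3] otherWinning = true := by
  cases g <;> decide +kernel

theorem calmCheck_other (g : Bool) :
    calmCheck 8 (code g) (!g) [4, 5, 6] [5, 6] [2, 3] otherWinning otherCalm = true := by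
  cases g <;> decide +kernel

/-- The symbols that a player can choose. -/
def avail (g s : Bool) : Set (Fin 3) := {i | s = g → i ≠ 2}

/-- The symbols that a player can secure if the opponent moves first. -/
def good (g s : Bool) : Set (Fin 3) := {i | if s = g then i ≠ 2 else i ≠ 0}

/-- The favored player uses two symbols, one for each copy of the cells. The other player has a
symbol `0` for choosing options, which need not be good, and two good symbols for threats on the two
copies. -/
theorem hasSwitch (g : Bool) : HasSwitch 8 (Fin 3) (avail g) (good g) := by
  refine ⟨Fin 8, inferInstance, inferInstance, fun w => decode g (code g (Nat.ofBits w)),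
    fun v w hvw => ?_, by simp, fun s => ?_⟩
  · exact sideLe_of_monotoneCheck (decode g) (monotoneCheck_code g) rfl rfl hvw
  · obtain rfl | rfl : s = g ∨ s = !g := by cases s <;> cases g <;> simp
    · refine ⟨tableStrategy (decode s) rfl rfl ?_ ?_ ?_ (winningCheck_favored s)
        (calmCheck_favored s) (by decide)⟩ <;> simp [decode, avail, good, Fin.forall_fin_succ]
    · refine ⟨tableStrategy (decode g) rfl rfl ?_ ?_ ?_ (winningCheck_other g)
        (calmCheck_other g) (by decide)⟩ <;> simp [decode, avail, good, Fin.forall_fin_succ]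

end BiasedSwitch

/-! ### Realizability -/

section Realizable

variable {A : Type u} [PartialOrder A]

/-- The set coloring game with a given payoff function. -/
abbrev cellGame {Z : Type} [Finite Z] (p : (Z → Bool) →o A) : SetColoringGame A where
  carrier := Z
  finite_carrier := inferInstance
  payoff := p

/-- Cells outside the range of `f` do not influence the payoff. This allows padding with irrelevant
cells, so that all options can be realized with the same size. -/
theorem SetColoringGame.equivalent_value (S T : SetColoringGame A) (f : S.carrier → T.carrier)
    (hf : Function.Injective f) (h : ∀ w, S.payoff (w ∘ f) = T.payoff w) :
    S.value.Equivalent T.value :=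
  equivalent_iff_sLe.2 fun _ => SetColoringGame.positionValue_sLe S T f hf
    (fun w => h w ▸ sideLe_refl _ _) fun _ => .inl rfl

theorem Game.RealizableWithSize.exists_payoff {G : Game A} {m n : ℕ}
    (h : G.RealizableWithSize m) (hmn : m ≤ n) :
    ∃ p : (Fin n → Bool) →o A, G.Equivalent (cellGame p).value := by
  obtain ⟨S, hS, hG⟩ := h
  have := S.finite_carrier
  let e : S.carrier ≃ Fin m := (Finite.equivFin S.carrier).trans (finCongr hS)
  let f : S.carrier → Fin n := fun c => Fin.castLE hmn (e c)
  refine ⟨⟨fun w => S.payoff (w ∘ f), fun v w hvw => S.payoff.monotone fun c => hvw _⟩,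
    hG.trans (S.equivalent_value _ f ?_ fun w => rfl)⟩
  exact (Fin.castLE_injective hmn).comp e.injective

theorem Game.RealizableWithSize.mono {G : Game A} {m n : ℕ} (h : G.RealizableWithSize m)
    (hmn : m ≤ n) : G.RealizableWithSize n := by
  obtain ⟨p, hp⟩ := h.exists_payoff hmn
  exact ⟨cellGame p, by simp [SetColoringGame.size], hp⟩

theorem realizableWithSize_zero_of_isAtomic {G : Game A} (h : G.IsAtomic) :
    G.RealizableWithSize 0 := by
  obtain ⟨a, rfl⟩ := h
  let S : SetColoringGame A := cellGame (OrderHom.const (Fin 0 → Bool) a)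
  refine ⟨S, by simp [S, SetColoringGame.size], ?_⟩
  have h : (fun c : Fin 0 => some (c.elim0 : Bool)) = fun _ : Fin 0 => (none : Option Bool) :=
    funext fun c => c.elim0
  have h' : S.value = atom a := by
    unfold SetColoringGame.value
    exact (congrArg S.positionValue h.symm).trans (S.positionValue_some _)
  rw [h']
  exact equivalent_iff_sLe.2 fun s => SLe.refl s _

end Realizable

/-! ### Enumerations of finite sets -/

theorem exists_enumeration {α : Type*} {S : Set α} (hS : S.Finite) {x₀ : α} (hx₀ : x₀ ∈ S)
    {N : ℕ} (hN : S.ncard ≤ N) :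
    ∃ f : ℕ → α, f 0 = x₀ ∧ (∀ m, f m ∈ S) ∧ ∀ x ∈ S, ∃ m < N, f m = x := by
  classical
  have := hS.fintype
  have hpos : 0 < S.ncard := (Set.ncard_pos hS).2 ⟨x₀, hx₀⟩
  let e : S ≃ Fin S.ncard := Finite.equivFin S
  -- The transposition gives `x₀` the number `0`; numbers that are too large also stand for `x₀`.
  let e' := e.trans (Equiv.swap (e ⟨x₀, hx₀⟩) ⟨0, hpos⟩)
  refine ⟨fun m => if h : m < S.ncard then (e'.symm ⟨m, h⟩).1 else x₀, ?_, fun m => ?_,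
    fun x hx => ?_⟩
  · simp [hpos, e']
  · dsimp only
    split_ifs
    · exact Subtype.coe_prop _
    · exact hx₀
  · refine ⟨e' ⟨x, hx⟩, (e' ⟨x, hx⟩).2.trans_le hN, ?_⟩
    simp

/-! ### One composite game -/

section OptionCode

variable {A : Type u} [PartialOrder A] {G : Game A} {k n : ℕ}

/-- An encoding of the options of `G` by numbers below `2 ^ k`, and payoff functions on `n` cells
that realize them. -/
structure OptionCode (G : Game A) (k n : ℕ) where
  /-- The option with a given number. -/
  option : Bool → ℕ → Game A
  /-- The payoff function for the option with a given number. -/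
  payoff : Bool → ℕ → (Fin n → Bool) →o A
  option_mem : ∀ s m, option s m ∈ opts s G
  exists_option : ∀ s, ∀ K ∈ opts s G, ∃ m < 2 ^ k, option s m = K
  equivalent : ∀ s m, (option s m).Equivalent (cellGame (payoff s m)).value

theorem exists_optionCode (hfin : ∀ s, (opts s G).Finite) (hcard : ∀ s, (opts s G).ncard ≤ 2 ^ k)
    (hreal : ∀ s, ∀ K ∈ opts s G, K.RealizableWithSize n) (K₀ : Bool → Game A)
    (hK₀ : ∀ s, K₀ s ∈ opts s G) : ∃ C : OptionCode G k n, ∀ s, C.option s 0 = K₀ s := by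
  choose f hf₀ hf hf' using fun s => exists_enumeration (hfin s) (hK₀ s) (hcard s)
  choose p hp using fun s m => (hreal s _ (hf s m)).exists_payoff le_rfl
  exact ⟨⟨f, p, hf, hf', hp⟩, hf₀⟩

theorem OptionCode.sLe_positionValue (C : OptionCode G k n) {T : SetColoringGame A}
    {q : T.Position} {j : Fin n → T.carrier} (hj : Function.Injective j) {s t : Bool} {m : ℕ}
    (hq : ∀ c, q (j c) = none)
    (hpay : ∀ w : T.carrier → Bool, (∀ d x, q d = some x → w d = x) →
      sideLe s (C.payoff t m fun c => w (j c)) (T.payoff w)) :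
    SLe s (C.option t m) (T.positionValue q) :=
  ((C.equivalent t m).sLe s).trans (SetColoringGame.positionValue_sLe_of_compatible
    (cellGame (C.payoff t m)) T j hj hpay fun c => .inl (hq c).symm)

namespace OptionCode

variable (C : OptionCode G k n)

theorem injective_mk_some (b : Bool) :
    Function.Injective fun c : Fin n => ((b, some c) : Bool × Option (Fin n)) :=
  fun c d h => by simpa using h

/-- An option on one of two copies of the cells, each of which has an additional cell. -/
def optionPayoff (t : Bool) (m : ℕ) (b : Bool) : (Bool × Option (Fin n) → Bool) →o A where
  toFun w := C.payoff t m fun c => w (b, some c)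
  monotone' _ _ h := (C.payoff t m).monotone fun _ => h _

theorem sLe_optionPayoff {s t b : Bool} {m : ℕ} {p : (Bool × Option (Fin n) → Bool) →o A}
    (hp : p = C.optionPayoff t m b) {z : Bool × Option (Fin n) → Option Bool}
    (hz : ∀ c, z (b, c) = none) :
    SLe s (C.option t m) ((cellGame p).positionValue z) := by
  subst hp
  exact C.sLe_positionValue (T := cellGame (C.optionPayoff t m b)) (j := fun c => (b, some c))
    (injective_mk_some b) (fun c => hz _) fun _ _ => sideLe_refl _ _

end OptionCode

end OptionCode

section Step

variable {A : Type u} [PartialOrder A] [BoundedOrder A] {G : Game A} {k n : ℕ}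

open SwitchStrategy (emptyPosition)

theorem HasSwitch.realizableWithSize {N : ℕ} {ι Z : Type} [Finite Z] {avail good : Bool → Set ι}
    (h : HasSwitch N ι avail good) (pay : Bool → ι → (Z → Bool) →o A) (hG : ¬ G.IsAtomic)
    (h_mine : ∀ s, ∀ K ∈ opts s G, ∃ i ∈ avail s, SLe s K (outcomeGame pay (.sym s i)).value)
    (h_theirs : ∀ s j, STri s G (outcomeGame pay (.sym (!s) j)).value)
    (h_good : ∀ s, ∀ i ∈ good s, SLe s G (outcomeGame pay (.sym s i)).value)
    (h_cell : ∀ s, ∀ c : Z, ∃ i ∈ avail s, SLe s G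
      ((outcomeGame pay (.sym s i)).positionValue
        ((outcomeGame pay (.sym s i)).color (emptyPosition Z) c !s))) :
    G.RealizableWithSize (N + Nat.card Z) := by
  obtain ⟨E, _, _, φ, hφ, hE, hσ⟩ := h
  refine ⟨switchGame φ hφ pay, ?_, equivalent_iff_sLe.2 fun s => ?_⟩
  · rw [← hE]
    exact Nat.card_sum
  · obtain ⟨σ⟩ := hσ s
    exact σ.sLe_switchGame_value hG (h_mine s) (h_theirs s) (h_good s) (h_cell s)

theorem color_emptyPosition_of_ne {Z : Type} [Finite Z] {ι : Type}
    {pay : Bool → ι → (Z → Bool) →o A} {o : Outcome ι} {c d : Z} {x : Bool} (h : d ≠ c) :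
    (outcomeGame pay o).color (emptyPosition Z) c x d = none :=
  (outcomeGame pay o).color_of_ne _ _ h

namespace OptionCode

variable (C : OptionCode G k n)

/-- The payoff functions for a game with good left and right options: a symbol determines an
option and one of two copies of the cells. -/
def copyPayoff (s : Bool) (x : Codes Bool k) : (Bool × Fin n → Bool) →o A where
  toFun w := C.payoff s x.index fun c => w (x.root, c)
  monotone' _ _ h := (C.payoff s x.index).monotone fun _ => h _

theorem sLe_copyPayoff {s t : Bool} {x : Codes Bool k} {z : Bool × Fin n → Option Bool}
    (hz : ∀ c, z (x.root, c) = none) :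
    SLe s (C.option t x.index) ((outcomeGame C.copyPayoff (.sym t x)).positionValue z) :=
  C.sLe_positionValue (T := outcomeGame C.copyPayoff (.sym t x)) (Prod.mk_right_injective x.root)
    hz fun _ _ => sideLe_refl _ _

/-- The base switch and its extensions have `7 + 4 * k` cells, and two copies of the cells of the
options add `2 * n`. -/
theorem realizableWithSize_of_good (hgood : ∀ s, SLe s G (C.option s 0)) (hG : ¬ G.IsAtomic) :
    G.RealizableWithSize (2 * n + (4 * k + 7)) := by
  have h := (TwoSymbolSwitch.hasSwitch.extend k).realizableWithSize C.copyPayoff hG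
    (fun s K hK => ?_) (fun s j => ?_) (fun s x hx => ?_) fun s c => ?_
  · convert h using 1
    simp
    ring
  · obtain ⟨m, hm, rfl⟩ := C.exists_option s K hK
    refine ⟨Codes.make false k m, trivial, ?_⟩
    have := C.sLe_copyPayoff (s := s) (t := s) (x := Codes.make false k m)
      (z := fun _ => none) fun _ => rfl
    rwa [Codes.index_make _ _ _ hm] at this
  -- The opponent's symbol names an option that the opponent can also move to in `G`.
  · exact sTri_of_reply_left (C.option_mem (!s) _) (C.sLe_copyPayoff fun _ => rfl)
  · have := C.sLe_copyPayoff (s := s) (t := s) (x := x) (z := fun _ => none) fun _ => rfl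
    rw [hx.2] at this
    exact (hgood s).trans this
  -- The opponent has moved in the copy `c.1`; the good option, with number `0`, is chosen on the
  -- other copy.
  · refine ⟨Codes.make (!c.1) k 0, trivial, (hgood s).trans ?_⟩
    have := C.sLe_copyPayoff (s := s) (t := s) (x := Codes.make (!c.1) k 0)
      (z := (outcomeGame C.copyPayoff (.sym s (Codes.make (!c.1) k 0))).color (emptyPosition _) c !s)
      fun d => color_emptyPosition_of_ne (by
        rw [Codes.root_make]
        intro h
        have := congrArg Prod.fst h
        simp at this)
    rwa [Codes.index_make _ _ _ (by positivity)] at this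

-- Games in which only one player is known to have a good option.

/-- The game in which the color of an additional cell selects between the good option of `g` and a
win of the opponent. -/
def threatPayoff (g b : Bool) : (Bool × Option (Fin n) → Bool) →o A where
  toFun w :=
    if w (b, none) = g then C.payoff g 0 fun c => w (b, some c) else if g then ⊥ else ⊤
  monotone' v w h := by
    have h₁ := h (b, none)
    have h₂ := (C.payoff g 0).monotone (show (fun c => v (b, some c)) ≤ fun c => w (b, some c)
      from fun c => h _)
    dsimp only
    revert h₁
    cases g <;> cases v (b, none) <;> cases w (b, none) <;> simp [h₂]

theorem threatPayoff_of_eq {g b : Bool} {w : Bool × Option (Fin n) → Bool} (h : w (b, none) = g) :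
    C.threatPayoff g b w = C.payoff g 0 fun c => w (b, some c) :=
  if_pos h

theorem threatPayoff_of_eq_not {g b : Bool} {w : Bool × Option (Fin n) → Bool}
    (h : w (b, none) = !g) : C.threatPayoff g b w = if g then ⊥ else ⊤ :=
  if_neg (by simp [h])

/-- The payoff functions for a game in which only the player `g` has a good option. -/
def biasedPayoff (g s : Bool) (x : Codes (Fin 3) k) : (Bool × Option (Fin n) → Bool) →o A :=
  if s = g ∨ x.root = 0 then C.optionPayoff s x.index (decide (x.root = 1))
  else C.threatPayoff g (decide (x.root = 1))

/-- If `g` colors the additional cell, then the good option of `g` remains. -/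
theorem sLe_threatPayoff_color {s g b : Bool} {p : (Bool × Option (Fin n) → Bool) →o A}
    (hp : p = C.threatPayoff g b) {z : Bool × Option (Fin n) → Option Bool}
    (hz : ∀ c, z (b, c) = none) :
    SLe s (C.option g 0) ((cellGame p).positionValue ((cellGame p).color z (b, none) g)) := by
  subst hp
  let T := cellGame (C.threatPayoff g b)
  refine C.sLe_positionValue (T := T) (j := fun c => (b, some c))
    (injective_mk_some b) (fun c => ?_) fun w hw => ?_
  · exact (T.color_of_ne z g fun h => by cases congrArg Prod.snd h).trans (hz _)
  · have h : w (b, none) = g := hw (b, none) g (T.color_self _ _ _)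
    exact (C.threatPayoff_of_eq h).symm ▸ sideLe_refl s (C.payoff g 0 fun c => w (b, some c))

/-- If the opponent colors the additional cell, then the opponent wins. -/
theorem sLe_threatPayoff_color_not {g b : Bool} {p : (Bool × Option (Fin n) → Bool) →o A}
    (hp : p = C.threatPayoff g b) {z : Bool × Option (Fin n) → Option Bool} (K : Game A) :
    SLe (!g) K ((cellGame p).positionValue ((cellGame p).color z (b, none) !g)) := by
  subst hp
  let T := cellGame (C.threatPayoff g b)
  -- This family only serves to present the constant winning payoff as an `outcomeGame`; its value
  -- at symbols is irrelevant.
  let pay : Bool → Unit → (Bool × Option (Fin n) → Bool) →o A := fun _ _ => C.threatPayoff g b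
  refine (sLe_outcomeGame_ext pay (!g) K (T.color z (b, none) !g)).trans
    (SetColoringGame.positionValue_sLe_of_compatible (outcomeGame pay (.ext !g)) T id
      Function.injective_id (fun w hw => ?_) fun c => .inl rfl)
  have h : w (b, none) = !g := hw (b, none) (!g) (T.color_self _ _ _)
  refine (C.threatPayoff_of_eq_not h).symm ▸ ?_
  cases g <;> simp [sideLe, outcomePayoff]

/-- The player `!g` can win by coloring the additional cell, so `g` must color it. What remains is
the good option of `g`, to which `g` can also move in `G`. Thus the threat serves `!g` as a good
option would. -/
theorem sLe_threatPayoff {g b : Bool} {p : (Bool × Option (Fin n) → Bool) →o A}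
    (hp : p = C.threatPayoff g b) {z : Bool × Option (Fin n) → Option Bool}
    (hz : ∀ c, z (b, c) = none) :
    SLe (!g) G ((cellGame p).positionValue z) := by
  have tri {K : Game A} {z : Bool × Option (Fin n) → Option Bool} (h : z (b, none) = none) :
      STri (!g) K ((cellGame p).positionValue z) :=
    (cellGame p).sTri_of_move (c := (b, none)) h (C.sLe_threatPayoff_color_not hp K)
  refine (cellGame p).sLe_positionValue (fun X _ => tri (hz _)) (fun c hc => ?_)
    fun _ => tri (hz _)
  rw [Bool.not_not]
  by_cases h : c = (b, none)
  · subst h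
    refine sTri_of_reply_left ?_ (C.sLe_threatPayoff_color hp hz)
    rw [Bool.not_not]
    exact C.option_mem g 0
  · exact tri (((cellGame p).color_of_ne z g (Ne.symm h)).trans (hz _))

/-- Conversely, `g` parries the threat by coloring the additional cell and obtains the good option,
which is at least as good for `g` as `G`. -/
theorem sTri_threatPayoff {g b : Bool} (hg : SLe g G (C.option g 0))
    {p : (Bool × Option (Fin n) → Bool) →o A} (hp : p = C.threatPayoff g b) :
    STri g G (cellGame p).value :=
  (cellGame p).sTri_of_move (c := (b, none)) rfl
    (hg.trans (C.sLe_threatPayoff_color hp fun _ => rfl))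

/-- The switch has `8 + 4 * k` cells, and two copies of `n + 1` cells are added. -/
theorem realizableWithSize_of_biased {g : Bool} (hg : SLe g G (C.option g 0)) (hG : ¬ G.IsAtomic) :
    G.RealizableWithSize (2 * n + (4 * k + 10)) := by
  have hz (b : Bool) (c : Bool × Option (Fin n)) (hb : b ≠ c.1) (x : Bool)
      (p : (Bool × Option (Fin n) → Bool) →o A) (d) :
      (cellGame p).color (emptyPosition _) c x (b, d) = none :=
    (cellGame p).color_of_ne _ _ fun h => hb (congrArg Prod.fst h)
  have h := ((BiasedSwitch.hasSwitch g).extend k).realizableWithSize (C.biasedPayoff g) hG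
    (fun s K hK => ?_) (fun s j => ?_) (fun s x hx => ?_) fun s c => ?_
  · convert h using 1
    simp
    ring
  · obtain ⟨m, hm, rfl⟩ := C.exists_option s K hK
    refine ⟨Codes.make 0 k m, ?_, C.sLe_optionPayoff (b := false) ?_ fun _ => rfl⟩
    · simp [Codes.root_make, BiasedSwitch.avail]
    · change C.biasedPayoff g s _ = _
      simp [biasedPayoff, Codes.root_make, Codes.index_make _ _ _ hm]
  · by_cases hj : (!s) = g ∨ j.root = 0
    · exact sTri_of_reply_left (C.option_mem (!s) j.index)
        (C.sLe_optionPayoff (if_pos hj) fun _ => rfl)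
    · obtain rfl : s = g := by
        push Not at hj
        simpa using hj.1
      exact C.sTri_threatPayoff hg (if_neg hj)
  · obtain ⟨hx, hx'⟩ := hx
    by_cases hs : s = g
    · subst hs
      refine hg.trans (C.sLe_optionPayoff (b := decide (x.root = 1)) ?_ fun _ => rfl)
      change C.biasedPayoff s s x = _
      rw [← hx', biasedPayoff, if_pos (.inl rfl)]
    · obtain rfl : s = !g := Bool.eq_not.2 hs
      refine C.sLe_threatPayoff (if_neg ?_) fun _ => rfl
      simpa [BiasedSwitch.good] using hx
  · by_cases hs : s = g
    · subst hs
      refine ⟨Codes.make (if c.1 then 0 else 1) k 0, ?_,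
        hg.trans (C.sLe_optionPayoff (b := !c.1) ?_ fun d => hz _ _ (by simp) _ _ d)⟩
      · simp only [Set.mem_ofPred_eq, Codes.root_make, BiasedSwitch.avail]
        split_ifs <;> simp
      · change C.biasedPayoff s s _ = _
        rw [biasedPayoff, if_pos (.inl rfl), Codes.root_make,
          Codes.index_make _ _ _ (by positivity)]
        cases c.1 <;> simp
    · obtain rfl : s = !g := Bool.eq_not.2 hs
      -- The threats `1` and `2` live on the copies `true` and `false`; the one on the untouched
      -- copy is chosen.
      refine ⟨Codes.make (if c.1 then 2 else 1) k 0, ?_,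
        C.sLe_threatPayoff (b := !c.1) ?_ fun d => hz _ _ (by simp) _ _ d⟩
      · simp [BiasedSwitch.avail]
      · change C.biasedPayoff g (!g) _ = _
        rw [biasedPayoff, Codes.root_make]
        cases c.1 <;> simp

end OptionCode

theorem realizableWithSize_of_monotone (hG : ¬ G.IsAtomic) (hfin : ∀ s, (opts s G).Finite)
    (hcard : ∀ s, (opts s G).ncard ≤ 2 ^ k)
    (hreal : ∀ s, ∀ K ∈ opts s G, K.RealizableWithSize n) (hgood : G.LocallyMonotone) :
    G.RealizableWithSize (2 * n + (4 * k + 7)) := by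
  choose K₀ hK₀ using G.isAtomic_or_opts_nonempty.resolve_left hG
  obtain ⟨C, hC⟩ := exists_optionCode hfin hcard hreal K₀ hK₀
  refine C.realizableWithSize_of_good (fun s => ?_) hG
  rw [hC]
  cases s
  · exact hgood.2 _ (hK₀ false)
  · exact hgood.1 _ (hK₀ true)

theorem realizableWithSize_of_passable (hG : ¬ G.IsAtomic) (hfin : ∀ s, (opts s G).Finite)
    (hcard : ∀ s, (opts s G).ncard ≤ 2 ^ k)
    (hreal : ∀ s, ∀ K ∈ opts s G, K.RealizableWithSize n) (hgood : G.LocallyPassable) :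
    G.RealizableWithSize (2 * n + (4 * k + 10)) := by
  choose K₀ hK₀ using G.isAtomic_or_opts_nonempty.resolve_left hG
  obtain ⟨g, K, hK, hle⟩ : ∃ g, ∃ K ∈ opts g G, SLe g G K := by
    obtain ⟨K, hK, h⟩ | ⟨K, hK, h⟩ := hgood.resolve_left hG
    · exact ⟨true, K, hK, h⟩
    · exact ⟨false, K, hK, h⟩
  -- The number `0` of `g` is reserved for the good option `K`; the option with number `0` of the
  -- other player is arbitrary.
  obtain ⟨C, hC⟩ := exists_optionCode hfin hcard hreal (Function.update K₀ g K) fun s => by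
    by_cases h : s = g
    · subst h
      simpa using hK
    · simpa [h] using hK₀ s
  refine C.realizableWithSize_of_biased (g := g) ?_ hG
  simpa [hC] using hle

end Step

/-! ### Finite games -/

namespace Game

section Finite

variable {A : Type u} {G H K : Game A}

theorem positions_subset (h : H ∈ G.positions) : H.positions ⊆ G.positions :=
  fun _ hK => Relation.ReflTransGen.trans hK h

theorem IsOption.mem_positions (h : H.IsOption G) : H ∈ G.positions := .single h

theorem IsFinite.of_mem_positions (hG : G.IsFinite) (h : H ∈ G.positions) : H.IsFinite :=
  hG.subset (positions_subset h)

theorem IsFinite.finite_opts (hG : G.IsFinite) (s : Bool) : (opts s G).Finite :=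
  hG.subset fun _ h => (isOption_of_mem_opts h).mem_positions

theorem IsFinite.depth_lt (hG : G.IsFinite) (h : H.IsOption G) : H.depth < G.depth := by
  have : Finite {H : Game A // IsOption H G} :=
    (hG.subset fun K (hK : K.IsOption G) => hK.mem_positions).to_subtype
  rw [depth.eq_def G]
  exact le_ciSup (f := fun H : {H : Game A // IsOption H G} => depth H.1 + 1)
    (Set.finite_range _).bddAbove ⟨H, h⟩

theorem IsFinite.ncard_opts_le (hG : G.IsFinite) (h : H ∈ G.positions) (s : Bool) :
    (opts s H).ncard ≤ G.branchingFactor := by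
  refine le_csSup ?_ ⟨H, h, ?_⟩
  · refine (((hG.image fun H => H.leftOptions.ncard).union
      (hG.image fun H => H.rightOptions.ncard)).subset ?_).bddAbove
    rintro _ ⟨H, hH, rfl | rfl⟩
    · exact .inl ⟨H, hH, rfl⟩
    · exact .inr ⟨H, hH, rfl⟩
  · cases s
    · exact .inr rfl
    · exact .inl rfl

end Finite

variable {A : Type u} [PartialOrder A]

/-- All options of a game of depth `d + 1` have depth at most `d`, so after padding they share the
size `(2 ^ d - 1) * c`, and `2 * (2 ^ d - 1) + 1 = 2 ^ (d + 1) - 1`. -/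
theorem IsFinite.realizableWithSize {G : Game A} (hG : G.IsFinite) {c : ℕ}
    (step : ∀ H ∈ G.positions, ¬ H.IsAtomic → ∀ n,
      (∀ s, ∀ K ∈ opts s H, K.RealizableWithSize n) → H.RealizableWithSize (2 * n + c)) :
    G.RealizableWithSize ((2 ^ G.depth - 1) * c) := by
  induction G using option_induction with | _ G ih
  by_cases hA : G.IsAtomic
  · exact (realizableWithSize_zero_of_isAtomic hA).mono (Nat.zero_le _)
  obtain ⟨K, hK⟩ := (isAtomic_or_opts_nonempty G).resolve_left hA true
  obtain ⟨d, hd⟩ : ∃ d, G.depth = d + 1 :=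
    Nat.exists_eq_add_one.2 (Nat.zero_lt_of_lt (hG.depth_lt (isOption_of_mem_opts hK)))
  have h := step G .refl hA ((2 ^ d - 1) * c) fun s K hK => by
    have hK' := isOption_of_mem_opts hK
    refine (ih s K hK (hG.of_mem_positions hK'.mem_positions) fun H hH =>
      step H (positions_subset hK'.mem_positions hH)).mono ?_
    have := hG.depth_lt hK'
    gcongr
    · exact one_le_two
    · omega
  convert h using 1
  -- Writing `2 ^ d = e + 1` removes the truncated subtraction.
  obtain ⟨e, he⟩ := Nat.exists_eq_add_one.2 (Nat.two_pow_pos d)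
  rw [hd, pow_succ, he, show (e + 1) * 2 - 1 = 2 * e + 1 by omega, Nat.add_sub_cancel]
  ring

end Game

end PosetGame

theorem proposition4p5 {A : Type u} [PartialOrder A] [BoundedOrder A] (G : PosetGame.Game A)
    (hG : G.IsFinite) :
    (G.IsMonotone →
      G.RealizableWithSize ((2 ^ G.depth - 1) * (4 * Nat.clog 2 G.branchingFactor + 7))) ∧
    (G.IsPassable →
      G.RealizableWithSize ((2 ^ G.depth - 1) * (4 * Nat.clog 2 G.branchingFactor + 10))) := by
  have hcard (H) (hH : H ∈ G.positions) (s : Bool) :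
      (PosetGame.Game.opts s H).ncard ≤ 2 ^ Nat.clog 2 G.branchingFactor :=
    (hG.ncard_opts_le hH s).trans (Nat.le_pow_clog Nat.one_lt_two _)
  refine ⟨fun h => hG.realizableWithSize fun H hH hA n hreal => ?_,
    fun h => hG.realizableWithSize fun H hH hA n hreal => ?_⟩
  · exact PosetGame.realizableWithSize_of_monotone hA (hG.of_mem_positions hH).finite_opts
      (hcard H hH) hreal (h H hH)
  · exact PosetGame.realizableWithSize_of_passable hA (hG.of_mem_positions hH).finite_opts
      (hcard H hH) hreal (h H hH)
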